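/- Let $n$ binary cells each be programmed (have their state changed) at most $\ell$ times during $t$ writes. For a cell-program-count vector $v\in\{0,\dots,\ell\}^n$ the current cell states are $\langle v\rangle_2 = v \bmod 2$. Programming the target state vector $c\in\{0,1\}^n$ on top of $v$ yields the new count vector $N(v,c)$, where $N(v,c)_k=v_k$ if $c_k\equiv v_k \pmod 2$ and $N(v,c)_k=\min\{\ell,v_k+1\}$ otherwise, and the new state vector $f(v,c)=\langle N(v,c)\rangle_2$; that is, $f(v,c)_k=c_k$ if $v_k<\ell$, and $f(v,c)_k=v_k \bmod 2$ if $v_k=\ell$. An $\ell$-change $t$-write ELM (endurance-limited memory) code on $n\ge 1$ cells consists, for each write $1\le j\le t$, of a number of messages $M_j\ge 1$, an encoder $\mathcal E_j$ and a decoder $\mathcal D_j$. In the EU:DIA model (encoder uninformed) the encoder is a map $\mathcal E_j(m)\in\{0,1\}^n$ of the message $m$ only; in the EIP:DIA model (encoder informed partially) it is a map $\mathcal E_j(m,\langle v\rangle_2)\in\{0,1\}^n$ of the message and the current cell states. In both models the decoder is informed of everything: it maps the state vector $f(v,c)$ after the $j$-th write, where $c$ is the output of $\mathcal E_j$, together with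 the count vector $v$ before this write, to a message. The count vector is $0$ before the first write, the messages of the $t$ writes are independent, and the $j$-th one is uniform on its $M_j$ values; the error probability $P_j$ of the $j$-th write is the probability that $\mathcal D_j$ does not return the $j$-th message. A tuple $(R_1,\dots,R_t)$ of nonnegative reals is $\epsilon$-error achievable in a model if for every $\epsilon>0$ there are an $n\ge1$ and a code of this model on $n$ cells with $P_j\le\epsilon$ and $\frac{\log_2 M_j}{n}\ge R_j-\epsilon$ for all $1\le j\le t$. Let $\mathcal C^{EU:DIA,\epsilon}_{t,\ell}$ and $\mathcal C^{EIP:DIA,\epsilon}_{t,\ell}$ be the sets of $\epsilon$-error achievable tuples of the two models, and let $\mathcal R^{EU:DIA,\epsilon}_{t,\ell}$ and $\mathcal R^{EIP:DIA,\epsilon}_{t,\ell}$ be the maxima of $R_1+\dots+R_t$ over these sets. **Theorem.** Let $t>\ell\ge 2$. Then both maxima exist, $$\mathcal R^{EU:DIA,\epsilon}_{t,\ell}<\mathcal R^{EIP:DIA,\epsilon}_{t,\ell},\qquad\text{and hence}\qquad \mathcal C^{EU:DIA,\epsilon}_{t,\ell}\subsetneq\mathcal C^{EIP:DIA,\epsilon}_{t,\ell}.$$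 -/

import Mathlib

noncomputable section

namespace ELM

/-- Cell-state vectors: the binary states of `n` cells. -/
abbrev StateVec (n : ℕ) : Type := Fin n → Fin 2

/-- Cell-program-count vectors: how many times (at most `ℓ`) each of `n` cells was programmed. -/
abbrev CountVec (n ℓ : ℕ) : Type := Fin n → Fin (ℓ + 1)

/-- The reduction of a cell-program-count vector modulo `2`, i.e. the current cell states. -/
def parity {n ℓ : ℕ} (v : CountVec n ℓ) : StateVec n :=
  fun k => ⟨(v k : ℕ) % 2, Nat.mod_lt _ Nat.two_pos⟩

/-- `N(v, c)`: the program counts after one attempts to bring cells with program counts `v`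
to the states `c`. A cell that already was programmed `ℓ` times does not change any more. -/
def newCount {n ℓ : ℕ} (v : CountVec n ℓ) (c : StateVec n) : CountVec n ℓ :=
  fun k =>
    if c k = parity v k then v k
    else ⟨min ℓ ((v k : ℕ) + 1), Nat.lt_succ_of_le (min_le_left _ _)⟩

/-- `f(v, c)`: the cell states after one attempts to bring cells with program counts `v`
to the states `c`. -/
def newState {n ℓ : ℕ} (v : CountVec n ℓ) (c : StateVec n) : StateVec n :=
  fun k => if (v k : ℕ) < ℓ then c k else parity v k

/-- The two encoder models: `EIP` (the encoder is informed partially, it knows the current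
cell states) and `EU` (the encoder is uninformed). -/
inductive Encoder : Type
  | EIP
  | EU

/-- The values that the knowledge of the encoder about `n` cells can take. -/
def Encoder.View : Encoder → ℕ → Type
  | .EIP, n => StateVec n
  | .EU, _ => Unit

/-- What the encoder knows about cells with program counts `v`. -/
def Encoder.view : (X : Encoder) → {n ℓ : ℕ} → CountVec n ℓ → X.View n
  | .EIP, _, _, v => parity v
  | .EU, _, _, _ => ()

/-- An `ℓ`-change `t`-write endurance-limited memory code on `n` cells in the model `X:DIA`:
on each write the encoder maps the message, and what it knows about the cells, to the cell
states to be programmed; the decoder maps the resulting cell states, and the program counts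
before that write, to a message. The writes `1, …, t` are indexed by `Fin t`. -/
structure Code (X : Encoder) (n t ℓ : ℕ) where
  /-- the number of messages of each write -/
  M : Fin t → ℕ
  M_pos : ∀ j, 0 < M j
  /-- the encoding maps -/
  enc : ∀ j : Fin t, Fin (M j) → X.View n → StateVec n
  /-- the decoding maps -/
  dec : ∀ j : Fin t, StateVec n → CountVec n ℓ → Fin (M j)

variable {X : Encoder} {n t ℓ : ℕ}

/-- The cell states that the encoder asks for when it writes the message `m` on write `j` to
cells with program counts `v`. -/
def Code.target (C : Code X n t ℓ) (j : Fin t) (m : Fin (C.M j)) (v : CountVec n ℓ) :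
    StateVec n :=
  C.enc j m (X.view v)

/-- The probability that the cell-program-count vector is `v` after the first `j` writes, when
the messages are independent and the message of each write is uniformly distributed. -/
def Code.countProb (C : Code X n t ℓ) : (j : ℕ) → j ≤ t → CountVec n ℓ → ℝ
  | 0, _, v => if v = 0 then 1 else 0
  | j + 1, h, v =>
      ∑ m : Fin (C.M ⟨j, h⟩), ∑ u : CountVec n ℓ,
        (1 / (C.M ⟨j, h⟩ : ℝ)) * C.countProb j (Nat.le_of_succ_le h) u *
          (if newCount u (C.target ⟨j, h⟩ m u) = v then 1 else 0)

/-- The probability of a decoding error on write `j`. -/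
def Code.errorProb (C : Code X n t ℓ) (j : Fin t) : ℝ :=
  ∑ m : Fin (C.M j), ∑ v : CountVec n ℓ,
    (1 / (C.M j : ℝ)) * C.countProb j j.isLt.le v *
      (if C.dec j (newState v (C.target j m v)) v = m then 0 else 1)

/-- The rate on write `j`, in bits per cell. -/
def Code.rate (C : Code X n t ℓ) (j : Fin t) : ℝ :=
  Real.logb 2 (C.M j) / n

/-- The rate tuple `R` is `ε`-error achievable in the model `X:DIA`. -/
def Achievable (X : Encoder) (t ℓ : ℕ) (R : Fin t → ℝ) : Prop :=
  ∀ ε : ℝ, 0 < ε → ∃ n : ℕ, 0 < n ∧ ∃ C : Code X n t ℓ,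
    ∀ j : Fin t, C.errorProb j ≤ ε ∧ R j - ε ≤ C.rate j

/-- The `ε`-error capacity region of the model `X:DIA`: all `ε`-error achievable tuples of
(nonnegative) rates. -/
def capacityRegion (X : Encoder) (t ℓ : ℕ) : Set (Fin t → ℝ) :=
  {R | (∀ j, 0 ≤ R j) ∧ Achievable X t ℓ R}

/-- The sum-rates of the `ε`-error achievable rate tuples of the model `X:DIA`. -/
def sumRates (X : Encoder) (t ℓ : ℕ) : Set ℝ :=
  (fun R : Fin t → ℝ => ∑ j, R j) '' capacityRegion X t ℓ

/-- The `ε`-error maximum sum-rate of the model `X:DIA`. -/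
def maxSumRate (X : Encoder) (t ℓ : ℕ) : ℝ :=
  sSup (sumRates X t ℓ)

end ELM

end

/-! Both models reduce to one cell. Such a cell is a Markov chain on its program count, driven by a
kernel `q j s`: the probability of requesting state `1` on write `j` when the current state is `s`.
Each write earns the entropy of the request, provided that the cell is not yet exhausted
(`cellRate`). Converse for uninformed encoders: the request is independent of the counts, so each
cell follows the chain of a kernel that does not depend on `s`. A Fano-type comparison with product
laws then bounds the sum-rate by the maximum of `cellSumRate` over such kernels
(`Code.log_le_sum_cellRate`, `sum_mul_log_two_le_of_achievable`). Direct part for partially informed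
encoders: random coding achieves the rates of every interior kernel, state-dependent or not
(`achievable_cellRate`). The gap (`exists_cellSumRate_gap`): an optimal state-independent kernel is
interior, because entropy has infinite slope at `0` and `1`. Perturb it on the second to last write
from one state only. From the parity of `ℓ - 2`, a request cannot decide whether a cell is alive at
the last write, so stationarity forces the parameter `1/2`. From the parity of `ℓ - 1`, flipping a
cell of count `ℓ - 1` kills it; the derivative therefore has an additional nonzero term and cannot
vanish at `1/2` as well. Some state-dependent kernel is thus strictly better. The maxima exist
because the capacity regions are compact and nonempty; equal regions would have equal maximal
sum-rates, so the inclusion is strict. -/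

noncomputable section

namespace ELM

/-! ### The Markov chain of a single cell. -/

/-- The state of a cell that was programmed `a` times. -/
def cellState {ℓ : ℕ} (a : Fin (ℓ + 1)) : Fin 2 :=
  ⟨(a : ℕ) % 2, Nat.mod_lt _ Nat.two_pos⟩

/-- The program count of a single cell after one attempts to bring it to the state `c`. -/
def cellCount {ℓ : ℕ} (a : Fin (ℓ + 1)) (c : Fin 2) : Fin (ℓ + 1) :=
  if c = cellState a then a else ⟨min ℓ ((a : ℕ) + 1), Nat.lt_succ_of_le (min_le_left _ _)⟩

/-- The state of a single cell after one attempts to bring it to the state `c`. -/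
def cellOutput {ℓ : ℕ} (a : Fin (ℓ + 1)) (c : Fin 2) : Fin 2 :=
  if (a : ℕ) < ℓ then c else cellState a

lemma newState_apply {n ℓ : ℕ} (v : CountVec n ℓ) (c : StateVec n) (k : Fin n) :
    newState v c k = cellOutput (v k) (c k) := rfl

/-- The weights of the Bernoulli distribution with parameter `p`. -/
def bern (p : ℝ) (c : Fin 2) : ℝ := if c = 1 then p else 1 - p

lemma sum_bern (p : ℝ) : ∑ c, bern p c = 1 := by
  simp [bern, Fin.sum_univ_two]

lemma bern_nonneg {p : ℝ} (hp : p ∈ Set.Icc (0 : ℝ) 1) (c : Fin 2) : 0 ≤ bern p c := by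
  unfold bern; split_ifs <;> linarith [hp.1, hp.2]

lemma bern_pos {p : ℝ} (hp : p ∈ Set.Ioo (0 : ℝ) 1) (c : Fin 2) : 0 < bern p c := by
  unfold bern; split_ifs <;> linarith [hp.1, hp.2]

lemma sum_bern_mul_neg_log (p : ℝ) :
    ∑ c, bern p c * -Real.log (bern p c) = Real.binEntropy p := by
  simp [bern, Fin.sum_univ_two, Real.binEntropy, Real.log_inv, add_comm]

/-- The distribution of the program count of a single cell after `j` writes, when on write `i`
a cell in state `s` is asked to go to state `1` with probability `q i s`. -/
def cellProb (ℓ : ℕ) (q : ℕ → Fin 2 → ℝ) : ℕ → Fin (ℓ + 1) → ℝ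
  | 0, a => if a = 0 then 1 else 0
  | j + 1, a =>
      ∑ u : Fin (ℓ + 1), ∑ c : Fin 2,
        cellProb ℓ q j u * bern (q j (cellState u)) c * (if cellCount u c = a then 1 else 0)

/-- The conditional entropy, in nats, of the new state of a cell on write `j`. -/
def cellRate (ℓ : ℕ) (q : ℕ → Fin 2 → ℝ) (j : ℕ) : ℝ :=
  ∑ u : Fin (ℓ + 1),
    cellProb ℓ q j u * (if (u : ℕ) < ℓ then Real.binEntropy (q j (cellState u)) else 0)

/-- The sum of `cellRate` over `t` writes. -/
def cellSumRate (ℓ t : ℕ) (q : ℕ → Fin 2 → ℝ) : ℝ := ∑ j ∈ Finset.range t, cellRate ℓ q j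

lemma sum_cellProb_zero (ℓ : ℕ) (q : ℕ → Fin 2 → ℝ) (g : Fin (ℓ + 1) → ℝ) :
    ∑ a, cellProb ℓ q 0 a * g a = g 0 := by
  simp [cellProb]

/-- The transition is tested against functions; this weak form is what later comparisons of laws
use. -/
lemma sum_cellProb_succ (ℓ : ℕ) (q : ℕ → Fin 2 → ℝ) (j : ℕ) (g : Fin (ℓ + 1) → ℝ) :
    ∑ a, cellProb ℓ q (j + 1) a * g a =
      ∑ u, cellProb ℓ q j u * ∑ c, bern (q j (cellState u)) c * g (cellCount u c) := by
  simp only [cellProb, Finset.sum_mul]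
  rw [Finset.sum_comm]
  refine Finset.sum_congr rfl fun u _ => ?_
  rw [Finset.sum_comm, Finset.mul_sum]
  refine Finset.sum_congr rfl fun c _ => ?_
  simp [mul_assoc]

lemma sum_cellProb (ℓ : ℕ) (q : ℕ → Fin 2 → ℝ) (j : ℕ) : ∑ a, cellProb ℓ q j a = 1 := by
  induction j with
  | zero => simpa using sum_cellProb_zero ℓ q 1
  | succ j ih =>
    have := sum_cellProb_succ ℓ q j 1
    simpa only [Pi.one_apply, mul_one, sum_bern, ih] using this

lemma cellProb_nonneg {ℓ : ℕ} {q : ℕ → Fin 2 → ℝ} (hq : ∀ j s, q j s ∈ Set.Icc (0 : ℝ) 1)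
    (j : ℕ) (a : Fin (ℓ + 1)) : 0 ≤ cellProb ℓ q j a := by
  induction j generalizing a with
  | zero => unfold cellProb; split_ifs <;> norm_num
  | succ j ih =>
    unfold cellProb
    refine Finset.sum_nonneg fun u _ => Finset.sum_nonneg fun c _ => ?_
    refine mul_nonneg (mul_nonneg (ih u) (bern_nonneg (hq _ _) c)) ?_
    split_ifs <;> norm_num

lemma cellProb_congr {ℓ : ℕ} {q q' : ℕ → Fin 2 → ℝ} {j : ℕ} (h : ∀ i < j, q i = q' i) :
    cellProb ℓ q j = cellProb ℓ q' j := by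
  induction j with
  | zero => rfl
  | succ j ih =>
    funext a
    simp only [cellProb, ih fun i hi => h i (hi.trans j.lt_succ_self), h j j.lt_succ_self]

/-- Under interior parameters a cell can both stay and advance, so every count up to `j` is
reachable. Only the writes before `j` need be interior, which permits a strong induction on the
write in `mem_Ioo_of_isMax_cellSumRate`. -/
lemma cellProb_pos {ℓ : ℕ} {q : ℕ → Fin 2 → ℝ} {j : ℕ} (hq : ∀ i < j, ∀ s, q i s ∈ Set.Ioo (0 : ℝ) 1)
    (hq' : ∀ i s, q i s ∈ Set.Icc (0 : ℝ) 1) (a : Fin (ℓ + 1)) (ha : (a : ℕ) ≤ j) :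
    0 < cellProb ℓ q j a := by
  induction j generalizing a with
  | zero =>
    have : a = 0 := Fin.ext (by simpa using ha)
    simp [cellProb, this]
  | succ j ih =>
    have ih := ih fun i hi => hq i (hi.trans j.lt_succ_self)
    have key : ∃ (u : Fin (ℓ + 1)) (c : Fin 2), (u : ℕ) ≤ j ∧ cellCount u c = a := by
      rcases Nat.lt_or_ge j a with h | h
      · have hu : (a : ℕ) - 1 < ℓ + 1 := by omega
        refine ⟨⟨a - 1, hu⟩, cellState (⟨a - 1, hu⟩ : Fin (ℓ + 1)) + 1, by simp; omega, ?_⟩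
        have : cellState (⟨a - 1, hu⟩ : Fin (ℓ + 1)) + 1 ≠ cellState (⟨a - 1, hu⟩ : Fin (ℓ + 1)) := by
          generalize cellState (⟨a - 1, hu⟩ : Fin (ℓ + 1)) = x
          fin_cases x <;> decide
        rw [cellCount, if_neg this]
        ext
        have := a.isLt
        simp only
        omega
      · exact ⟨a, cellState a, h, by simp [cellCount]⟩
    obtain ⟨u, c, hu, huc⟩ := key
    have hnn : ∀ (u : Fin (ℓ + 1)) (c : Fin 2), 0 ≤ cellProb ℓ q j u * bern (q j (cellState u)) c *
        (if cellCount u c = a then 1 else 0) := fun u c =>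
      mul_nonneg (mul_nonneg (cellProb_nonneg hq' j u) (bern_nonneg (hq' _ _) c))
        (by split_ifs <;> norm_num)
    unfold cellProb
    refine Finset.sum_pos' (fun u _ => Finset.sum_nonneg fun c _ => hnn u c)
      ⟨u, Finset.mem_univ _, Finset.sum_pos' (fun c _ => hnn u c) ⟨c, Finset.mem_univ _, ?_⟩⟩
    rw [if_pos huc, mul_one]
    exact mul_pos (ih u hu) (bern_pos (hq j j.lt_succ_self _) c)

/-! ### Laws of codes and a Fano-type inequality. -/

variable {X : Encoder} {n t ℓ : ℕ}

lemma Code.sum_countProb_zero (C : Code X n t ℓ) (g : CountVec n ℓ → ℝ) :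
    ∑ v, C.countProb 0 t.zero_le v * g v = g 0 := by
  simp [Code.countProb]

lemma Code.sum_countProb_succ (C : Code X n t ℓ) (j : ℕ) (h : j + 1 ≤ t) (g : CountVec n ℓ → ℝ) :
    ∑ v, C.countProb (j + 1) h v * g v =
      ∑ m, ∑ u, 1 / (C.M ⟨j, h⟩ : ℝ) * C.countProb j (Nat.le_of_succ_le h) u *
        g (newCount u (C.target ⟨j, h⟩ m u)) := by
  simp only [Code.countProb, Finset.sum_mul]
  rw [Finset.sum_comm]
  refine Finset.sum_congr rfl fun m _ => ?_
  rw [Finset.sum_comm]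
  refine Finset.sum_congr rfl fun u _ => ?_
  simp

lemma Code.M_ne_zero (C : Code X n t ℓ) (j : Fin t) : (C.M j : ℝ) ≠ 0 := by
  exact_mod_cast (C.M_pos j).ne'

lemma Code.sum_countProb (C : Code X n t ℓ) (j : ℕ) (h : j ≤ t) :
    ∑ v, C.countProb j h v = 1 := by
  induction j with
  | zero => simpa using C.sum_countProb_zero 1
  | succ j ih =>
    have := C.sum_countProb_succ j h 1
    simpa [mul_assoc, ← Finset.mul_sum, ih, C.M_ne_zero] using this

lemma Code.countProb_nonneg (C : Code X n t ℓ) (j : ℕ) (h : j ≤ t) (v : CountVec n ℓ) :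
    0 ≤ C.countProb j h v := by
  induction j generalizing v with
  | zero => unfold Code.countProb; split_ifs <;> norm_num
  | succ j ih =>
    unfold Code.countProb
    refine Finset.sum_nonneg fun m _ => Finset.sum_nonneg fun u _ => ?_
    refine mul_nonneg (mul_nonneg (by positivity) (ih _ u)) ?_
    split_ifs <;> norm_num

/-- A version of Fano's inequality: comparison with any family `W` of distributions of the
new states. -/
lemma Code.one_sub_errorProb_mul_log_le (C : Code X n t ℓ) (j : Fin t)
    (W : CountVec n ℓ → StateVec n → ℝ) (hW : ∀ v y, 0 ≤ W v y) (hW1 : ∀ v, ∑ y, W v y = 1)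
    (hpos : ∀ m v, 0 < W v (newState v (C.target j m v))) :
    (1 - C.errorProb j) * Real.log (C.M j) ≤ C.errorProb j +
      ∑ m, ∑ v, 1 / (C.M j : ℝ) * C.countProb j j.isLt.le v *
        -Real.log (W v (newState v (C.target j m v))) := by
  have hM : (0 : ℝ) < C.M j := by exact_mod_cast C.M_pos j
  set P : Fin (C.M j) → CountVec n ℓ → ℝ :=
    fun _ v => 1 / (C.M j : ℝ) * C.countProb j j.isLt.le v with hP
  have hP0 : ∀ m v, 0 ≤ P m v := fun m v => mul_nonneg (by positivity) (C.countProb_nonneg _ _ _)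
  have hPsum : ∑ m, ∑ v, P m v = 1 := by
    simp [hP, ← Finset.mul_sum, C.sum_countProb, hM.ne']
  set w : Fin (C.M j) → CountVec n ℓ → ℝ := fun m v => W v (newState v (C.target j m v)) with hw
  set e : Fin (C.M j) → CountVec n ℓ → ℝ :=
    fun m v => if C.dec j (newState v (C.target j m v)) v = m then 0 else 1 with he
  have herr : C.errorProb j = ∑ m, ∑ v, P m v * e m v := rfl
  -- When decoding is correct this is `log x ≤ x - 1` at `x = M w`; otherwise the left side vanishes
  -- and `-log w ≥ 0`. Summed, the bracket contributes at most `1 - (1 - errorProb)`, which replaces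
  -- the usual entropy term of Fano.
  have hpt : ∀ m v, P m v * (1 - e m v) * Real.log (C.M j) ≤
      P m v * -Real.log (w m v) + (C.countProb j j.isLt.le v * ((1 - e m v) * w m v) -
        P m v * (1 - e m v)) := by
    intro m v
    have h1 : w m v ≤ 1 := by
      rw [← hW1 v]
      exact Finset.single_le_sum (fun y _ => hW v y) (Finset.mem_univ _)
    have h2 : 0 ≤ -Real.log (w m v) := by
      have := Real.log_nonpos (hpos m v).le h1
      linarith
    have h3 : Real.log (C.M j) + Real.log (w m v) ≤ C.M j * w m v - 1 := by
      rw [← Real.log_mul hM.ne' (hpos m v).ne']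
      exact Real.log_le_sub_one_of_pos (mul_pos hM (hpos m v))
    have h4 : C.countProb j j.isLt.le v = P m v * C.M j := by
      simp only [hP]; field_simp
    rw [h4]
    have h5 := hP0 m v
    by_cases hd : C.dec j (newState v (C.target j m v)) v = m
    · have : e m v = 0 := by simp [he, hd]
      rw [this]
      nlinarith
    · have : e m v = 1 := by simp [he, hd]
      rw [this]
      have := mul_nonneg h5 h2
      linarith
  -- For fixed `v`, correctly decoded messages have distinct outputs, so their `W v`-masses add up
  -- to at most `1`.
  have hinj : ∀ v, ∑ m, (1 - e m v) * w m v ≤ 1 := by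
    intro v
    calc ∑ m, (1 - e m v) * w m v
        ≤ ∑ m, ∑ y, if C.dec j y v = m then W v y else 0 := by
          refine Finset.sum_le_sum fun m _ => ?_
          have hnn : ∀ y ∈ Finset.univ, 0 ≤ if C.dec j y v = m then W v y else 0 := by
            intro y _
            split_ifs
            exacts [hW v y, le_rfl]
          refine le_trans ?_ (Finset.single_le_sum hnn
            (Finset.mem_univ (newState v (C.target j m v))))
          simp only [he, hw]
          split_ifs <;> simp
      _ = ∑ y, W v y := by
          rw [Finset.sum_comm]
          simp
      _ = 1 := hW1 v
  have hsum := Finset.sum_le_sum fun m (_ : m ∈ Finset.univ) =>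
    Finset.sum_le_sum fun v (_ : v ∈ Finset.univ) => hpt m v
  have hA : ∑ m, ∑ v, P m v * (1 - e m v) = 1 - C.errorProb j := by
    simp only [mul_sub, mul_one, Finset.sum_sub_distrib, hPsum, herr]
  have hB : ∑ m, ∑ v, C.countProb j j.isLt.le v * ((1 - e m v) * w m v) ≤ 1 := by
    rw [Finset.sum_comm]
    refine le_trans ?_ (C.sum_countProb j j.isLt.le).le
    refine Finset.sum_le_sum fun v _ => ?_
    rw [← Finset.mul_sum]
    exact mul_le_of_le_one_right (C.countProb_nonneg _ _ _) (hinj v)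
  simp only [Finset.sum_add_distrib, Finset.sum_sub_distrib, ← Finset.sum_mul, hA] at hsum
  linarith

lemma Code.errorProb_nonneg (C : Code X n t ℓ) (j : Fin t) : 0 ≤ C.errorProb j := by
  refine Finset.sum_nonneg fun m _ => Finset.sum_nonneg fun v _ => ?_
  refine mul_nonneg (mul_nonneg (by positivity) (C.countProb_nonneg _ _ _)) ?_
  split_ifs <;> norm_num

/-- Comparison with the uniform law on states. The bound is crude, but it serves only to bound the
capacity region. -/
lemma Code.rate_le (C : Code X n t ℓ) (hn : 0 < n) (j : Fin t) (h : C.errorProb j ≤ 1 / 2) :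
    C.rate j ≤ 2 + 1 / Real.log 2 := by
  have hl2 : 0 < Real.log 2 := Real.log_pos (by norm_num)
  have hn1 : (1 : ℝ) ≤ n := by exact_mod_cast hn
  have hM : (0 : ℝ) < C.M j := by exact_mod_cast C.M_pos j
  have key := C.one_sub_errorProb_mul_log_le j (fun _ _ => (1 / 2) ^ n) (fun _ _ => by positivity)
    (fun v => by simp) (fun _ _ => by positivity)
  have hlog : -Real.log ((1 / 2 : ℝ) ^ n) = n * Real.log 2 := by
    rw [Real.log_pow, one_div, Real.log_inv]; ring
  simp only [hlog, ← Finset.sum_mul, ← Finset.mul_sum, C.sum_countProb] at key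
  simp only [Finset.sum_const, Finset.card_univ, Fintype.card_fin, nsmul_eq_mul, mul_one] at key
  rw [mul_one_div_cancel hM.ne', one_mul] at key
  have h0 := C.errorProb_nonneg j
  have hM1 : 0 ≤ Real.log (C.M j) := Real.log_natCast_nonneg _
  have hbound : Real.log (C.M j) ≤ (2 * Real.log 2 + 1) * n := by
    nlinarith
  have : Real.log (C.M j) / n ≤ 2 * Real.log 2 + 1 := by
    rwa [div_le_iff₀ (by linarith)]
  calc C.rate j = (Real.log (C.M j) / n) / Real.log 2 := by
        unfold Code.rate Real.logb; ring
    _ ≤ (2 * Real.log 2 + 1) / Real.log 2 := by gcongr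
    _ = 2 + 1 / Real.log 2 := by field_simp

/-! ### Single-letter converse for uninformed encoders. -/

/-- The probability that an uninformed encoder asks for state `1` of cell `k` on write `j`. -/
def Code.marginal (C : Code .EU n t ℓ) (k : Fin n) (j : ℕ) : ℝ :=
  if h : j < t then ∑ m : Fin (C.M ⟨j, h⟩), 1 / (C.M ⟨j, h⟩ : ℝ) *
    (if C.enc ⟨j, h⟩ m () k = 1 then 1 else 0) else 0

lemma Code.sum_bern_marginal (C : Code .EU n t ℓ) (k : Fin n) (j : Fin t) (g : Fin 2 → ℝ) :
    ∑ c, bern (C.marginal k j) c * g c =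
      ∑ m, 1 / (C.M j : ℝ) * g (C.enc j m () k) := by
  have h1 : ∀ m, g (C.enc j m () k) =
      (if C.enc j m () k = 1 then 1 else 0) * g 1 +
        (1 - (if C.enc j m () k = 1 then 1 else 0)) * g 0 := by
    intro m
    generalize C.enc j m () k = x
    fin_cases x <;> simp
  have h2 : C.marginal k j = ∑ m : Fin (C.M j), 1 / (C.M j : ℝ) *
    (if C.enc j m () k = 1 then 1 else 0) := by simp [Code.marginal]
  have h3 : ∑ _m : Fin (C.M j), 1 / (C.M j : ℝ) = 1 := by
    simp [C.M_ne_zero]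
  simp_rw [h1, mul_add, Finset.sum_add_distrib, ← mul_assoc, ← Finset.sum_mul, mul_sub, mul_one,
    Finset.sum_sub_distrib, h3, ← h2]
  simp [bern, Fin.sum_univ_two]
  ring

lemma Code.marginal_mem (C : Code .EU n t ℓ) (k : Fin n) (j : ℕ) :
    C.marginal k j ∈ Set.Icc (0 : ℝ) 1 := by
  unfold Code.marginal
  split_ifs with h
  · constructor
    · exact Finset.sum_nonneg fun m _ => by split_ifs <;> simp
    · have h3 : ∑ _m : Fin (C.M ⟨j, h⟩), 1 / (C.M ⟨j, h⟩ : ℝ) = 1 := by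
        simp [C.M_ne_zero]
      refine le_trans (Finset.sum_le_sum fun m _ => ?_) h3.le
      split_ifs <;> simp
  · simp

/-- A bit that some message requests has marginal probability at least `1 / M`. Hence the comparison
law is positive where needed, even if the marginal is `0` or `1`. -/
lemma Code.bern_marginal_pos (C : Code .EU n t ℓ) (k : Fin n) (j : Fin t) (m : Fin (C.M j)) :
    0 < bern (C.marginal k j) (C.enc j m () k) := by
  have h := C.sum_bern_marginal k j fun c => if c = C.enc j m () k then 1 else 0
  simp only [mul_ite, mul_one, mul_zero, Finset.sum_ite_eq', Finset.mem_univ, if_true] at h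
  rw [h]
  have hM : (0 : ℝ) < C.M j := by exact_mod_cast C.M_pos j
  exact Finset.sum_pos' (fun m _ => by split_ifs <;> positivity)
    ⟨m, Finset.mem_univ _, by simp only [if_true]; positivity⟩

/-- The message is independent of the past and an uninformed encoder uses nothing else, so the count
of each cell is exactly a single-cell chain, however the cells are correlated. -/
lemma Code.sum_countProb_coord (C : Code .EU n t ℓ) (k : Fin n) (j : ℕ) (hj : j ≤ t)
    (g : Fin (ℓ + 1) → ℝ) :
    ∑ v, C.countProb j hj v * g (v k) =
      ∑ a, cellProb ℓ (fun i _ => C.marginal k i) j a * g a := by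
  induction j generalizing g with
  | zero => rw [C.sum_countProb_zero fun v => g (v k), sum_cellProb_zero]; rfl
  | succ j ih =>
    rw [C.sum_countProb_succ j hj fun v => g (v k), sum_cellProb_succ]
    have h1 : ∀ m, ∑ u, 1 / (C.M ⟨j, hj⟩ : ℝ) * C.countProb j (Nat.le_of_succ_le hj) u *
        g (newCount u (C.target ⟨j, hj⟩ m u) k) = ∑ a, 1 / (C.M ⟨j, hj⟩ : ℝ) *
          (cellProb ℓ (fun i _ => C.marginal k i) j a *
            g (cellCount a (C.enc ⟨j, hj⟩ m () k))) := by
      intro m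
      rw [← Finset.mul_sum, ← ih (Nat.le_of_succ_le hj) fun a =>
        g (cellCount a (C.enc ⟨j, hj⟩ m () k)), Finset.mul_sum]
      exact Finset.sum_congr rfl fun u _ => mul_assoc _ _ _
    rw [Finset.sum_congr rfl fun m _ => h1 m]
    rw [Finset.sum_comm]
    refine Finset.sum_congr rfl fun a _ => ?_
    have := C.sum_bern_marginal k ⟨j, hj⟩ fun c => g (cellCount a c)
    rw [this, Finset.mul_sum]
    exact Finset.sum_congr rfl fun m _ => by ring

/-- The distribution of the new state of a cell of program count `a` for which state `1` is
requested with probability `p`. -/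
def cellKernel {ℓ : ℕ} (p : ℝ) (a : Fin (ℓ + 1)) (y : Fin 2) : ℝ :=
  if (a : ℕ) < ℓ then bern p y else if y = cellState a then 1 else 0

lemma sum_cellKernel (p : ℝ) (a : Fin (ℓ + 1)) : ∑ y, cellKernel p a y = 1 := by
  unfold cellKernel
  split_ifs with h
  · exact sum_bern p
  · simp

lemma cellKernel_nonneg {p : ℝ} (hp : p ∈ Set.Icc (0 : ℝ) 1) (a : Fin (ℓ + 1)) (y : Fin 2) :
    0 ≤ cellKernel p a y := by
  unfold cellKernel
  split_ifs
  exacts [bern_nonneg hp y, zero_le_one, le_rfl]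

lemma cellKernel_output (p : ℝ) (a : Fin (ℓ + 1)) (c : Fin 2) :
    cellKernel p a (cellOutput a c) = if (a : ℕ) < ℓ then bern p c else 1 := by
  unfold cellKernel cellOutput
  split_ifs <;> simp_all

/-- Single-letter converse for one write. -/
lemma Code.log_le_sum_cellRate (C : Code .EU n t ℓ) (j : Fin t) :
    (1 - C.errorProb j) * Real.log (C.M j) ≤ C.errorProb j +
      ∑ k, cellRate ℓ (fun i _ => C.marginal k i) j := by
  have hpos : ∀ m v k, 0 < cellKernel (C.marginal k j) (v k : Fin (ℓ + 1))
      (newState v (C.target j m v) k) := by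
    intro m v k
    rw [newState_apply, cellKernel_output]
    split_ifs
    exacts [C.bern_marginal_pos k j m, zero_lt_one]
  -- With a product as comparison law the logarithm splits over the cells, and each summand depends
  -- on one cell only; no independence of cells is required.
  have key := C.one_sub_errorProb_mul_log_le j
    (fun v y => ∏ k, cellKernel (C.marginal k j) (v k) (y k))
    (fun v y => Finset.prod_nonneg fun k _ => cellKernel_nonneg (C.marginal_mem k j) _ _)
    (fun v => by
      rw [← Fintype.piFinset_univ, ← Finset.prod_univ_sum]
      simp only [sum_cellKernel, Finset.prod_const_one])
    (fun m v => Finset.prod_pos fun k _ => hpos m v k)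
  refine key.trans (add_le_add le_rfl (le_of_eq ?_))
  have h1 : ∀ m v, 1 / (C.M j : ℝ) * C.countProb j j.isLt.le v *
      -Real.log (∏ k, cellKernel (C.marginal k j) (v k) (newState v (C.target j m v) k)) =
      ∑ k, 1 / (C.M j : ℝ) * (C.countProb j j.isLt.le v *
        (if (v k : ℕ) < ℓ then -Real.log (bern (C.marginal k j) (C.enc j m () k)) else 0)) := by
    intro m v
    rw [Real.log_prod fun k _ => (hpos m v k).ne', ← Finset.sum_neg_distrib, Finset.mul_sum]
    refine Finset.sum_congr rfl fun k _ => ?_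
    rw [newState_apply, cellKernel_output, mul_assoc]
    congr 2
    split_ifs
    · rfl
    · simp
  simp_rw [h1]
  simp_rw [fun m => Finset.sum_comm (s := (Finset.univ : Finset (CountVec n ℓ)))
    (t := (Finset.univ : Finset (Fin n)))
    (f := fun v k => 1 / (C.M j : ℝ) * (C.countProb j j.isLt.le v *
        (if (v k : ℕ) < ℓ then -Real.log (bern (C.marginal k j) (C.enc j m () k)) else 0)))]
  rw [Finset.sum_comm]
  refine Finset.sum_congr rfl fun k _ => ?_
  simp_rw [← Finset.mul_sum]
  simp_rw [fun m => C.sum_countProb_coord k j j.isLt.le fun a => if (a : ℕ) < ℓ then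
    -Real.log (bern (C.marginal k j) (C.enc j m () k)) else 0, Finset.mul_sum]
  rw [Finset.sum_comm]
  unfold cellRate
  refine Finset.sum_congr rfl fun a _ => ?_
  split_ifs with h
  · rw [← sum_bern_mul_neg_log,
      C.sum_bern_marginal k j fun c => -Real.log (bern (C.marginal k j) c), Finset.mul_sum]
    exact Finset.sum_congr rfl fun m _ => by ring
  · simp

/-- The sum-rate converse for uninformed encoders. -/
lemma sum_mul_log_two_le_of_achievable {R : Fin t → ℝ} (hR : Achievable .EU t ℓ R) {S : ℝ}
    (hS : ∀ p : ℕ → ℝ, (∀ j, p j ∈ Set.Icc (0 : ℝ) 1) → cellSumRate ℓ t (fun j _ => p j) ≤ S) :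
    (∑ j, R j) * Real.log 2 ≤ S := by
  have hl2 : 0 < Real.log 2 := Real.log_pos (by norm_num)
  have key : ∀ ε : ℝ, 0 < ε → ε < 1 → (1 - ε) * ((∑ j, (R j - ε)) * Real.log 2) ≤ t * ε + S := by
    intro ε hε hε1
    obtain ⟨n, hn, C, hC⟩ := hR ε hε
    have hn1 : (1 : ℝ) ≤ n := by exact_mod_cast hn
    have h1 : ∀ j, (1 - ε) * (n * ((R j - ε) * Real.log 2)) ≤
        ε + ∑ k, cellRate ℓ (fun i _ => C.marginal k i) j := by
      intro j
      obtain ⟨he, hr⟩ := hC j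
      have h2 := C.log_le_sum_cellRate j
      have h3 : n * (C.rate j * Real.log 2) = Real.log (C.M j) := by
        unfold Code.rate Real.logb
        field_simp
      have h4 : n * ((R j - ε) * Real.log 2) ≤ Real.log (C.M j) := by
        rw [← h3]; gcongr
      have h5 : 0 ≤ Real.log (C.M j) := Real.log_natCast_nonneg _
      have h6 : (1 - ε) * (n * ((R j - ε) * Real.log 2)) ≤ (1 - ε) * Real.log (C.M j) :=
        mul_le_mul_of_nonneg_left h4 (by linarith)
      nlinarith
    have h2 := Finset.sum_le_sum fun j (_ : j ∈ Finset.univ) => h1 j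
    rw [← Finset.mul_sum, ← Finset.mul_sum, ← Finset.sum_mul, Finset.sum_add_distrib,
      Finset.sum_comm] at h2
    -- The bound `S` applies to each cell separately, with the marginals of that cell as its kernel.
    have h3 : ∑ k : Fin n, ∑ j : Fin t, cellRate ℓ (fun i _ => C.marginal k i) j ≤ n * S := by
      calc _ ≤ ∑ k : Fin n, S := by
            refine Finset.sum_le_sum fun k _ => ?_
            have := hS (C.marginal k) (C.marginal_mem k)
            rwa [cellSumRate, ← Fin.sum_univ_eq_sum_range] at this
        _ = n * S := by simp
    have h4 : ∑ _j : Fin t, ε = t * ε := by simp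
    rw [h4] at h2
    have h5 : (n : ℝ) * ((1 - ε) * ((∑ j, (R j - ε)) * Real.log 2)) ≤ n * (t * ε + S) := by
      have : (0 : ℝ) ≤ t * ε := by positivity
      nlinarith
    exact le_of_mul_le_mul_left h5 (by linarith)
  have hlim : Filter.Tendsto (fun ε : ℝ => (1 - ε) * ((∑ j, (R j - ε)) * Real.log 2))
      (nhdsWithin 0 (Set.Ioi 0)) (nhds ((∑ j, R j) * Real.log 2)) := by
    have : Continuous fun ε : ℝ => (1 - ε) * ((∑ j, (R j - ε)) * Real.log 2) := by fun_prop
    have h := this.tendsto 0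
    simp only [sub_zero, one_mul] at h
    exact h.mono_left nhdsWithin_le_nhds
  have hlim' : Filter.Tendsto (fun ε : ℝ => t * ε + S)
      (nhdsWithin 0 (Set.Ioi 0)) (nhds S) := by
    have : Continuous fun ε : ℝ => t * ε + S := by fun_prop
    have h := this.tendsto 0
    simp only [mul_zero, zero_add] at h
    exact h.mono_left nhdsWithin_le_nhds
  refine le_of_tendsto_of_tendsto hlim hlim' ?_
  filter_upwards [Ioo_mem_nhdsGT (zero_lt_one' ℝ)] with ε hε
  exact key ε hε.1 hε.2

/-! ### Independence and Chebyshev's inequality for finite product weights. -/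

section ProductWeights

variable {ι α : Type*} [Fintype ι] [DecidableEq ι] [Fintype α]

lemma sum_prod_eq_prod_sum (f : ι → α → ℝ) : ∑ x : ι → α, ∏ i, f i (x i) = ∏ i, ∑ a, f i a := by
  rw [Finset.prod_univ_sum, Fintype.piFinset_univ]

/-- Pairwise independence of coordinates. It serves twice: for the variance in Chebyshev's
inequality and for the collision of two random codewords. -/
lemma sum_prod_mul_eval_mul_eval {w : ι → α → ℝ} (hw : ∀ i, ∑ a, w i a = 1) {i i' : ι}
    (hi : i ≠ i') (g g' : α → ℝ) :
    ∑ x : ι → α, (∏ k, w k (x k)) * (g (x i) * g' (x i')) =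
      (∑ a, w i a * g a) * ∑ a, w i' a * g' a := by
  have h1 : ∀ x : ι → α, (∏ k, w k (x k)) * (g (x i) * g' (x i')) =
      ∏ k, (w k (x k) * ((if k = i then g (x k) else 1) * (if k = i' then g' (x k) else 1))) := by
    intro x
    rw [Finset.prod_mul_distrib, Finset.prod_mul_distrib]
    simp
  simp_rw [h1]
  rw [sum_prod_eq_prod_sum fun k a =>
    w k a * ((if k = i then g a else 1) * (if k = i' then g' a else 1))]
  have h2 : ∀ k, ∑ a, w k a * ((if k = i then g a else 1) * (if k = i' then g' a else 1)) =
      (if k = i then ∑ a, w k a * g a else 1) * (if k = i' then ∑ a, w k a * g' a else 1) := by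
    intro k
    by_cases h : k = i
    · subst h; simp [hi]
    · by_cases h' : k = i'
      · subst h'; simp [h]
      · simp [h, h', hw]
  rw [Finset.prod_congr rfl fun k _ => h2 k, Finset.prod_mul_distrib]
  simp

lemma sum_prod_weights {w : ι → α → ℝ} (hw : ∀ i, ∑ a, w i a = 1) :
    ∑ x : ι → α, ∏ k, w k (x k) = 1 := by
  rw [sum_prod_eq_prod_sum]
  simp [hw]

lemma sum_prod_mul_eval {w : ι → α → ℝ} (hw : ∀ i, ∑ a, w i a = 1) (i : ι) (g : α → ℝ) :
    ∑ x : ι → α, (∏ k, w k (x k)) * g (x i) = ∑ a, w i a * g a := by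
  have h1 : ∀ x : ι → α, (∏ k, w k (x k)) * g (x i) =
      ∏ k, (w k (x k) * (if k = i then g (x k) else 1)) := by
    intro x
    rw [Finset.prod_mul_distrib]
    simp
  simp_rw [h1]
  rw [sum_prod_eq_prod_sum fun k a => w k a * (if k = i then g a else 1)]
  have h2 : ∀ k, ∑ a, w k a * (if k = i then g a else 1) =
      (if k = i then ∑ a, w k a * g a else 1) := by
    intro k
    by_cases h : k = i
    · subst h; simp
    · simp [h, hw]
  rw [Finset.prod_congr rfl fun k _ => h2 k]
  simp

/-- Chebyshev's inequality for the sum of independent identically distributed variables on a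
finite set. -/
lemma sum_prod_lower_tail_le {w : α → ℝ} (hw0 : ∀ a, 0 ≤ w a) (hw : ∑ a, w a = 1) (g : α → ℝ)
    {n : ℕ} (hn : 0 < n) {δ : ℝ} (hδ : 0 < δ) :
    ∑ x : Fin n → α, (∏ k, w (x k)) *
        (if ∑ k, g (x k) < n * ((∑ a, w a * g a) - δ) then 1 else 0) ≤
      (∑ a, w a * (g a - ∑ b, w b * g b) ^ 2) / δ ^ 2 / n := by
  set r := ∑ a, w a * g a with hr
  set V := ∑ a, w a * (g a - r) ^ 2 with hV
  have hn' : (0 : ℝ) < n := by exact_mod_cast hn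
  have hmean : ∑ a, w a * (g a - r) = 0 := by
    simp [mul_sub, Finset.sum_sub_distrib, ← Finset.sum_mul, hw, ← hr]
  have hvar : ∑ x : Fin n → α, (∏ k, w (x k)) * (∑ k, (g (x k) - r)) ^ 2 = n * V := by
    have h1 : ∀ x : Fin n → α, (∏ k, w (x k)) * (∑ k, (g (x k) - r)) ^ 2 =
        ∑ i, ∑ i', (∏ k, w (x k)) * ((g (x i) - r) * (g (x i') - r)) := by
      intro x
      rw [sq, Finset.sum_mul_sum, Finset.mul_sum]
      exact Finset.sum_congr rfl fun i _ => Finset.mul_sum _ _ _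
    simp_rw [h1]
    rw [Finset.sum_comm]
    have h2 : ∀ i : Fin n, ∑ x : Fin n → α, ∑ i', (∏ k, w (x k)) *
        ((g (x i) - r) * (g (x i') - r)) = V := by
      intro i
      rw [Finset.sum_comm, Finset.sum_eq_single i]
      · rw [sum_prod_mul_eval (w := fun _ => w) (fun _ => hw) i
          fun a => (g a - r) * (g a - r)]
        exact Finset.sum_congr rfl fun a _ => by ring
      · intro i' _ hi'
        rw [sum_prod_mul_eval_mul_eval (w := fun _ => w) (fun _ => hw) hi'.symm
          (fun a => g a - r) (fun a => g a - r), hmean, zero_mul]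
      · simp
    simp [h2]
  calc _ ≤ ∑ x : Fin n → α, (∏ k, w (x k)) * ((∑ k, (g (x k) - r)) ^ 2 / (n * δ) ^ 2) := by
        refine Finset.sum_le_sum fun x _ => mul_le_mul_of_nonneg_left ?_
          (Finset.prod_nonneg fun k _ => hw0 _)
        split_ifs with h
        · rw [one_le_div (by positivity)]
          have h3 : ∑ k, (g (x k) - r) = ∑ k, g (x k) - n * r := by
            simp [Finset.sum_sub_distrib]
          rw [h3]
          have : 0 < n * δ := by positivity
          nlinarith
        · positivity
    _ = V / δ ^ 2 / n := by
        simp_rw [← mul_div_assoc]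
        rw [← Finset.sum_div, hvar]
        field_simp

end ProductWeights

/-! ### Random coding, one write at a time. -/

/-- A random code for one write: the average over independent codewords of the sum of the error
probability and of a function of the new counts bounds that of some code. -/
lemma exists_encoder (Q : StateVec n → StateVec n → ℝ) (hQ : ∀ s c, 0 ≤ Q s c)
    (hQ1 : ∀ s, ∑ c, Q s c = 1) {M : ℕ} (hM : 0 < M) (μ φ : CountVec n ℓ → ℝ) (hμ : ∀ v, 0 ≤ μ v)
    (T : CountVec n ℓ → StateVec n → Prop) [∀ v, DecidablePred (T v)] {γ : ℝ} (hγ0 : 0 ≤ γ)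
    (hγ : ∀ v y, T v y → ∑ c, Q (parity v) c * (if newState v c = y then 1 else 0) ≤ γ) :
    ∃ (enc : Fin M → StateVec n → StateVec n) (dec : StateVec n → CountVec n ℓ → Fin M),
      ∑ m, ∑ v, 1 / (M : ℝ) * μ v *
        ((if dec (newState v (enc m (parity v))) v = m then 0 else 1) +
          φ (newCount v (enc m (parity v)))) ≤
      ∑ v, μ v * ((∑ c, Q (parity v) c * (if T v (newState v c) then 0 else 1)) + (M - 1) * γ +
        ∑ c, Q (parity v) c * φ (newCount v c)) := by
  classical
  have hM' : (0 : ℝ) < M := by exact_mod_cast hM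
  -- A codebook has one independent codeword for each pair of a message and a current state vector
  -- `s`, drawn from `Q s`.
  let Wt : (Fin M × StateVec n → StateVec n) → ℝ := fun x => ∏ i, Q i.2 (x i)
  have hw : ∀ i : Fin M × StateVec n, ∑ a, Q i.2 a = 1 := fun i => hQ1 _
  have hWt0 : ∀ x, 0 ≤ Wt x := fun x => Finset.prod_nonneg fun i _ => hQ _ _
  have hWt1 : ∑ x, Wt x = 1 := sum_prod_weights hw
  -- The decoder knows `v`, hence which codewords were in use and how `v` distorts them. It returns
  -- some message consistent with `y`; the default `0` is arbitrary.
  let D : (Fin M × StateVec n → StateVec n) → StateVec n → CountVec n ℓ → Fin M := fun x y v =>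
    if h : ∃ m, newState v (x (m, parity v)) = y then h.choose else ⟨0, hM⟩
  let J : (Fin M × StateVec n → StateVec n) → ℝ := fun x => ∑ m, ∑ v, 1 / (M : ℝ) * μ v *
        ((if D x (newState v (x (m, parity v))) v = m then 0 else 1) +
          φ (newCount v (x (m, parity v))))
  have herr : ∀ x m v, (if D x (newState v (x (m, parity v))) v = m then (0 : ℝ) else 1) ≤
      (if T v (newState v (x (m, parity v))) then 0 else 1) +
        ∑ m' ∈ Finset.univ.erase m, ∑ y, (if T v y then 1 else 0) *
          ((if newState v (x (m, parity v)) = y then 1 else 0) *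
            (if newState v (x (m', parity v)) = y then 1 else 0)) := by
    intro x m v
    have hnn : ∀ m' y, (0 : ℝ) ≤ (if T v y then 1 else 0) *
          ((if newState v (x (m, parity v)) = y then 1 else 0) *
            (if newState v (x (m', parity v)) = y then 1 else 0)) := by
      intro m' y
      split_ifs <;> norm_num
    have hnn' := fun m' => Finset.sum_nonneg fun y (_ : y ∈ Finset.univ) => hnn m' y
    have hnn'' := Finset.sum_nonneg fun m' (_ : m' ∈ Finset.univ.erase m) => hnn' m'
    by_cases hT : T v (newState v (x (m, parity v)))
    · by_cases hD : D x (newState v (x (m, parity v))) v = m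
      · rw [if_pos hD, if_pos hT, zero_add]
        exact hnn''
      · rw [if_neg hD, if_pos hT, zero_add]
        have hex : ∃ m', newState v (x (m', parity v)) = newState v (x (m, parity v)) := ⟨m, rfl⟩
        have hDe : D x (newState v (x (m, parity v))) v = hex.choose := dif_pos hex
        rw [hDe] at hD
        refine le_trans ?_ (Finset.single_le_sum (fun m' _ => hnn' m')
          (Finset.mem_erase.2 ⟨hD, Finset.mem_univ _⟩))
        refine le_trans ?_ (Finset.single_le_sum (fun y _ => hnn _ y)
          (Finset.mem_univ (newState v (x (m, parity v)))))
        simp [hT, hex.choose_spec]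
    · rw [if_neg hT]
      have : (if D x (newState v (x (m, parity v))) v = m then (0 : ℝ) else 1) ≤ 1 := by
        split_ifs <;> norm_num
      linarith
  have hcol : ∀ m v, ∑ x, Wt x * ∑ m' ∈ Finset.univ.erase m, ∑ y, (if T v y then 1 else 0) *
          ((if newState v (x (m, parity v)) = y then 1 else 0) *
            (if newState v (x (m', parity v)) = y then 1 else 0)) ≤ (M - 1) * γ := by
    intro m v
    have h1 : ∀ m' ∈ Finset.univ.erase m, ∑ x, Wt x * ∑ y, (if T v y then 1 else 0) *
          ((if newState v (x (m, parity v)) = y then 1 else 0) *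
            (if newState v (x (m', parity v)) = y then 1 else 0)) ≤ γ := by
      intro m' hm'
      have hne : ((m, parity v) : Fin M × StateVec n) ≠ (m', parity v) := by
        intro h
        exact (Finset.mem_erase.1 hm').1 (Prod.ext_iff.1 h).1.symm
      simp_rw [Finset.mul_sum]
      rw [Finset.sum_comm]
      -- Independent codewords both produce `y` with probability the square of that of `y`; for `y`
      -- in `T v` one factor is at most `γ`.
      have h2 : ∀ y, ∑ x, Wt x * ((if T v y then 1 else 0) *
          ((if newState v (x (m, parity v)) = y then 1 else 0) *
            (if newState v (x (m', parity v)) = y then 1 else 0))) ≤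
          γ * ∑ c, Q (parity v) c * (if newState v c = y then 1 else 0) := by
        intro y
        have hS : 0 ≤ ∑ c, Q (parity v) c * (if newState v c = y then (1 : ℝ) else 0) :=
          Finset.sum_nonneg fun c _ => mul_nonneg (hQ _ _) (by split_ifs <;> norm_num)
        by_cases hT : T v y
        · simp only [if_pos hT, one_mul]
          rw [sum_prod_mul_eval_mul_eval hw hne (fun c => if newState v c = y then 1 else 0)
            (fun c => if newState v c = y then 1 else 0)]
          exact mul_le_mul_of_nonneg_right (hγ v y hT) hS
        · simp only [if_neg hT, zero_mul, mul_zero, Finset.sum_const_zero]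
          exact mul_nonneg hγ0 hS
      refine (Finset.sum_le_sum fun y _ => h2 y).trans ?_
      rw [← Finset.mul_sum, Finset.sum_comm]
      simp [hQ1]
    simp_rw [Finset.mul_sum (s := Finset.univ.erase m)]
    rw [Finset.sum_comm]
    refine (Finset.sum_le_sum h1).trans ?_
    rw [Finset.sum_const, Finset.card_erase_of_mem (Finset.mem_univ _), Finset.card_univ,
      Fintype.card_fin, nsmul_eq_mul, Nat.cast_sub hM, Nat.cast_one]
  have hone : ∀ m v, ∑ x, Wt x *
      ((if D x (newState v (x (m, parity v))) v = m then 0 else 1) +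
          φ (newCount v (x (m, parity v)))) ≤
      (∑ c, Q (parity v) c * (if T v (newState v c) then 0 else 1)) + (M - 1) * γ +
        ∑ c, Q (parity v) c * φ (newCount v c) := by
    intro m v
    have h1 := sum_prod_mul_eval hw (m, parity v) fun c => if T v (newState v c) then 0 else 1
    have h2 := sum_prod_mul_eval hw (m, parity v) fun c => φ (newCount v c)
    dsimp only at h1 h2
    rw [← h1, ← h2]
    refine le_trans ?_ (add_le_add (add_le_add le_rfl (hcol m v)) le_rfl)
    rw [← Finset.sum_add_distrib, ← Finset.sum_add_distrib]
    refine Finset.sum_le_sum fun x _ => ?_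
    have := mul_le_mul_of_nonneg_left (herr x m v) (hWt0 x)
    simp only [mul_add] at this ⊢
    linarith
  -- The best codebook is no worse than the average one.
  obtain ⟨x₀, hx₀⟩ := Finite.exists_min J
  refine ⟨fun m s => x₀ (m, s), D x₀, ?_⟩
  calc J x₀ = ∑ x, Wt x * J x₀ := by rw [← Finset.sum_mul, hWt1, one_mul]
    _ ≤ ∑ x, Wt x * J x :=
        Finset.sum_le_sum fun x _ => mul_le_mul_of_nonneg_left (hx₀ x) (hWt0 x)
    _ = ∑ m : Fin M, ∑ v, 1 / (M : ℝ) * μ v * ∑ x, Wt x *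
          ((if D x (newState v (x (m, parity v))) v = m then 0 else 1) +
            φ (newCount v (x (m, parity v)))) := by
        simp only [J, Finset.mul_sum]
        rw [Finset.sum_comm]
        refine Finset.sum_congr rfl fun m _ => ?_
        rw [Finset.sum_comm]
        exact Finset.sum_congr rfl fun v _ => Finset.sum_congr rfl fun x _ => by ring
    _ ≤ ∑ m : Fin M, ∑ v, 1 / (M : ℝ) * μ v *
          ((∑ c, Q (parity v) c * (if T v (newState v c) then 0 else 1)) + (M - 1) * γ +
            ∑ c, Q (parity v) c * φ (newCount v c)) :=
        Finset.sum_le_sum fun m _ => Finset.sum_le_sum fun v _ =>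
          mul_le_mul_of_nonneg_left (hone m v) (mul_nonneg (by positivity) (hμ v))
    _ = _ := by
        simp_rw [mul_assoc, ← Finset.mul_sum]
        rw [Finset.sum_const, Finset.card_univ, Fintype.card_fin, nsmul_eq_mul]
        field_simp

/-- The code with partially informed encoders given by families of encoders and decoders. -/
def ofMaps (t : ℕ) {M : ℕ → ℕ} (hM : ∀ j, 0 < M j)
    (enc : ∀ j, Fin (M j) → StateVec n → StateVec n)
    (dec : ∀ j, StateVec n → CountVec n ℓ → Fin (M j)) : Code .EIP n t ℓ where
  M j := M j
  M_pos j := hM j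
  enc j := enc j
  dec j := dec j

lemma countProb_ofMaps_congr {M : ℕ → ℕ} (hM : ∀ j, 0 < M j)
    {enc enc' : ∀ j, Fin (M j) → StateVec n → StateVec n}
    {dec dec' : ∀ j, StateVec n → CountVec n ℓ → Fin (M j)} {j : ℕ} (hj : j ≤ t)
    (h : ∀ i < j, enc i = enc' i) :
    (ofMaps t hM enc dec).countProb j hj = (ofMaps t hM enc' dec').countProb j hj := by
  induction j with
  | zero => rfl
  | succ j ih =>
    funext v
    simp only [Code.countProb, ih (Nat.le_of_succ_le hj) fun i hi => h i (hi.trans j.lt_succ_self)]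
    simp only [ofMaps, Code.target, h j j.lt_succ_self]
    rfl

lemma errorProb_ofMaps {M : ℕ → ℕ} (hM : ∀ j, 0 < M j)
    (enc : ∀ j, Fin (M j) → StateVec n → StateVec n)
    (dec : ∀ j, StateVec n → CountVec n ℓ → Fin (M j)) (j : Fin t) :
    (ofMaps t hM enc dec).errorProb j = ∑ m : Fin (M j), ∑ v, 1 / (M j : ℝ) *
      (ofMaps t hM enc dec).countProb j j.isLt.le v *
        (if dec j (newState v (enc j m (parity v))) v = m then 0 else 1) := rfl

/-- The expected sum, over `r` writes from write `j` on, of `e i` at the current counts, when the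
targets are chosen according to `Q`. -/
def expectedCost (Q : ℕ → StateVec n → StateVec n → ℝ) (e : ℕ → CountVec n ℓ → ℝ) :
    ℕ → ℕ → CountVec n ℓ → ℝ
  | 0, _, _ => 0
  | r + 1, j, v => e j v + ∑ c, Q j (parity v) c * expectedCost Q e r (j + 1) (newCount v c)

/-- Method of conditional expectations. The potential is the error of the writes already fixed plus
the expected cost of the remaining writes under random targets. Fixing the next write by
`exists_encoder`, with the future cost as `φ`, does not increase it. Errors of earlier writes
persist, as they do not depend on later maps. -/
lemma exists_code (Q : ℕ → StateVec n → StateVec n → ℝ) (hQ : ∀ j s c, 0 ≤ Q j s c)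
    (hQ1 : ∀ j s, ∑ c, Q j s c = 1) {M : ℕ → ℕ} (hM : ∀ j, 0 < M j)
    (T : ℕ → CountVec n ℓ → StateVec n → Prop) [∀ j v, DecidablePred (T j v)]
    {γ : ℕ → ℝ} (hγ0 : ∀ j, 0 ≤ γ j)
    (hγ : ∀ j v y, T j v y → ∑ c, Q j (parity v) c * (if newState v c = y then 1 else 0) ≤ γ j)
    (t : ℕ) :
    ∃ C : Code .EIP n t ℓ, (∀ j, C.M j = M j) ∧ ∑ j, C.errorProb j ≤
      expectedCost Q (fun j v => (∑ c, Q j (parity v) c *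
        (if T j v (newState v c) then 0 else 1)) + (M j - 1) * γ j) t 0 0 := by
  set e : ℕ → CountVec n ℓ → ℝ := fun j v => (∑ c, Q j (parity v) c *
        (if T j v (newState v c) then 0 else 1)) + (M j - 1) * γ j with he
  have key : ∀ k (hk : k ≤ t) r, k + r = t →
      ∃ (enc : ∀ j, Fin (M j) → StateVec n → StateVec n)
        (dec : ∀ j, StateVec n → CountVec n ℓ → Fin (M j)),
        ∑ j : Fin k, (ofMaps t hM enc dec).errorProb (Fin.castLE hk j) +
          ∑ v, (ofMaps t hM enc dec).countProb k hk v * expectedCost Q e r k v ≤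
          expectedCost Q e t 0 0 := by
    intro k
    induction k with
    | zero =>
      intro hk r hr
      refine ⟨fun j _ s => s, fun j _ _ => ⟨0, hM j⟩, ?_⟩
      obtain rfl : r = t := by omega
      rw [Code.sum_countProb_zero]
      simp
    | succ k ih =>
      intro hk r hr
      obtain ⟨enc, dec, h⟩ := ih (Nat.le_of_succ_le hk) (r + 1) (by omega)
      obtain ⟨enck, deck, hstep⟩ := exists_encoder (Q k) (hQ k) (hQ1 k) (hM k)
        ((ofMaps t hM enc dec).countProb k (Nat.le_of_succ_le hk)) (expectedCost Q e r (k + 1))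
        ((ofMaps t hM enc dec).countProb_nonneg k (Nat.le_of_succ_le hk)) (T k) (hγ0 k) (hγ k)
      refine ⟨Function.update enc k enck, Function.update dec k deck, ?_⟩
      set C := ofMaps t hM enc dec with hC
      set C' := ofMaps t hM (Function.update enc k enck) (Function.update dec k deck) with hC'
      have hcp : ∀ j (hj : j ≤ t), j ≤ k → C'.countProb j hj = C.countProb j hj := by
        intro j hj hjk
        exact countProb_ofMaps_congr hM hj fun i hi => Function.update_of_ne (by omega) _ _
      have herr : ∀ j : Fin k, C'.errorProb (Fin.castLE (Nat.le_of_succ_le hk) j) =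
          C.errorProb (Fin.castLE (Nat.le_of_succ_le hk) j) := by
        intro j
        have hj : (j : ℕ) ≠ k := j.isLt.ne
        have h1 := hcp j (j.isLt.le.trans (Nat.le_of_succ_le hk)) j.isLt.le
        have h2 : Function.update dec k deck (Fin.castLE (Nat.le_of_succ_le hk) j : Fin t) =
            dec (Fin.castLE (Nat.le_of_succ_le hk) j : Fin t) := Function.update_of_ne hj _ _
        have h3 : Function.update enc k enck (Fin.castLE (Nat.le_of_succ_le hk) j : Fin t) =
            enc (Fin.castLE (Nat.le_of_succ_le hk) j : Fin t) := Function.update_of_ne hj _ _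
        rw [errorProb_ofMaps, errorProb_ofMaps, h2, h3]
        simp only [← hC, ← hC', Fin.val_castLE, h1]
      have hdk : C'.dec ⟨k, hk⟩ = deck := Function.update_self ..
      have hek : C'.enc ⟨k, hk⟩ = enck := Function.update_self ..
      rw [Fin.sum_univ_castSucc]
      have hlast : C'.errorProb (Fin.castLE hk (Fin.last k)) +
          ∑ v, C'.countProb (k + 1) hk v * expectedCost Q e r (k + 1) v ≤
          ∑ v, C.countProb k (Nat.le_of_succ_le hk) v * expectedCost Q e (r + 1) k v := by
        refine le_trans (le_of_eq ?_) hstep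
        rw [Code.sum_countProb_succ]
        have h1 : C'.errorProb (Fin.castLE hk (Fin.last k)) = ∑ m, ∑ v, 1 / (M k : ℝ) *
            C.countProb k (Nat.le_of_succ_le hk) v *
              (if deck (newState v (enck m (parity v))) v = m then 0 else 1) := by
          have h2 := hcp k (Nat.le_of_succ_le hk) le_rfl
          rw [← hdk, ← hek, ← h2]
          rfl
        rw [h1, hcp k (Nat.le_of_succ_le hk) le_rfl]
        simp only [Code.target, hek]
        simp only [mul_add, Finset.sum_add_distrib]
        rfl
      have hsum : ∑ j : Fin k, C'.errorProb (Fin.castLE hk j.castSucc) =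
          ∑ j : Fin k, C.errorProb (Fin.castLE (Nat.le_of_succ_le hk) j) :=
        Finset.sum_congr rfl fun j _ => herr j
      rw [hsum]
      linarith
  obtain ⟨enc, dec, h⟩ := key t le_rfl 0 rfl
  refine ⟨ofMaps t hM enc dec, fun j => rfl, ?_⟩
  simpa [expectedCost] using h

/-! ### Product laws and achievability for partially informed encoders. -/

lemma sum_bern_mul_output (p : ℝ) (a : Fin (ℓ + 1)) (y : Fin 2) :
    ∑ c, bern p c * (if cellOutput a c = y then 1 else 0) = cellKernel p a y := by
  unfold cellOutput cellKernel
  by_cases h : (a : ℕ) < ℓ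
  · simp [h]
  · simp only [if_neg h, ← Finset.sum_mul, sum_bern, one_mul, eq_comm]

/-- The product law of the program counts of `n` cells after `j` writes. -/
def blockProb (n ℓ : ℕ) (q : ℕ → Fin 2 → ℝ) (j : ℕ) (v : CountVec n ℓ) : ℝ :=
  ∏ k, cellProb ℓ q j (v k)

/-- The product law of the targets on write `j`. -/
def blockKernel (q : ℕ → Fin 2 → ℝ) (j : ℕ) (s c : StateVec n) : ℝ :=
  ∏ k, bern (q j (s k)) (c k)

lemma sum_blockKernel (q : ℕ → Fin 2 → ℝ) (j : ℕ) (s : StateVec n) :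
    ∑ c, blockKernel q j s c = 1 :=
  sum_prod_weights (w := fun k => bern (q j (s k))) fun _ => sum_bern _

lemma prod_ite_eq_ite {β : Type*} [DecidableEq β] (f g : Fin n → β) :
    ∏ k, (if f k = g k then (1 : ℝ) else 0) = if f = g then 1 else 0 := by
  rw [Finset.prod_ite_zero]
  simp [funext_iff]

lemma sum_blockProb_zero (q : ℕ → Fin 2 → ℝ) (g : CountVec n ℓ → ℝ) :
    ∑ v, blockProb n ℓ q 0 v * g v = g 0 := by
  have h : ∀ v : CountVec n ℓ, blockProb n ℓ q 0 v = if v = 0 then 1 else 0 := fun v =>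
    prod_ite_eq_ite v 0
  simp [h]

lemma sum_blockProb_succ (q : ℕ → Fin 2 → ℝ) (j : ℕ) (g : CountVec n ℓ → ℝ) :
    ∑ v, blockProb n ℓ q (j + 1) v * g v =
      ∑ u, blockProb n ℓ q j u * ∑ c, blockKernel q j (parity u) c * g (newCount u c) := by
  have h : ∀ v, blockProb n ℓ q (j + 1) v =
      ∑ u : CountVec n ℓ, ∑ c : StateVec n, blockProb n ℓ q j u * blockKernel q j (parity u) c *
        (if newCount u c = v then 1 else 0) := by
    intro v
    simp only [blockProb, cellProb, blockKernel]
    rw [← sum_prod_eq_prod_sum]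
    refine Finset.sum_congr rfl fun u _ => ?_
    rw [← sum_prod_eq_prod_sum fun k c => cellProb ℓ q j (u k) * bern (q j (cellState (u k))) c *
      (if cellCount (u k) c = v k then 1 else 0)]
    refine Finset.sum_congr rfl fun c _ => ?_
    rw [Finset.prod_mul_distrib, Finset.prod_mul_distrib, ← prod_ite_eq_ite]
    rfl
  simp only [h, Finset.sum_mul]
  rw [Finset.sum_comm]
  refine Finset.sum_congr rfl fun u _ => ?_
  rw [Finset.sum_comm, Finset.mul_sum]
  refine Finset.sum_congr rfl fun c _ => ?_
  simp [mul_assoc]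

/-- Random targets act cell by cell and keep the counts independent, so the expected cost is a sum
of expectations under product laws, one for each write. -/
lemma sum_blockProb_mul_expectedCost (q : ℕ → Fin 2 → ℝ) (e : ℕ → CountVec n ℓ → ℝ) (r j : ℕ) :
    ∑ v, blockProb n ℓ q j v * expectedCost (blockKernel q) e r j v =
      ∑ i ∈ Finset.range r, ∑ v, blockProb n ℓ q (j + i) v * e (j + i) v := by
  induction r generalizing j with
  | zero => simp [expectedCost]
  | succ r ih =>
    simp only [expectedCost, mul_add, Finset.sum_add_distrib]
    rw [← sum_blockProb_succ, ih, Finset.sum_range_succ', add_comm]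
    simp only [add_zero]
    congr 1
    refine Finset.sum_congr rfl fun i _ => ?_
    rw [show j + 1 + i = j + (i + 1) by ring]

/-- The information, in nats, that the new state of a cell of count `x.1` carries when its target
is `x.2`. -/
def cellInfo (ℓ : ℕ) (q : ℕ → Fin 2 → ℝ) (j : ℕ) (x : Fin (ℓ + 1) × Fin 2) : ℝ :=
  if (x.1 : ℕ) < ℓ then -Real.log (bern (q j (cellState x.1)) x.2) else 0

/-- The joint law of the count of a cell and its target on write `j`. -/
def cellJoint (ℓ : ℕ) (q : ℕ → Fin 2 → ℝ) (j : ℕ) (x : Fin (ℓ + 1) × Fin 2) : ℝ :=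
  cellProb ℓ q j x.1 * bern (q j (cellState x.1)) x.2

lemma sum_cellJoint (q : ℕ → Fin 2 → ℝ) (j : ℕ) : ∑ x, cellJoint ℓ q j x = 1 := by
  rw [Fintype.sum_prod_type]
  simp only [cellJoint, ← Finset.mul_sum, sum_bern, mul_one, sum_cellProb]

lemma sum_cellJoint_mul_cellInfo (q : ℕ → Fin 2 → ℝ) (j : ℕ) :
    ∑ x, cellJoint ℓ q j x * cellInfo ℓ q j x = cellRate ℓ q j := by
  rw [Fintype.sum_prod_type]
  unfold cellRate
  refine Finset.sum_congr rfl fun a _ => ?_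
  simp only [cellJoint, cellInfo, mul_assoc, ← Finset.mul_sum]
  congr 1
  split_ifs
  · exact sum_bern_mul_neg_log _
  · simp

/-- This turns atypicality of the output into a lower-tail event for a sum over cells, to which
Chebyshev's inequality applies. -/
lemma prod_cellKernel_newState {q : ℕ → Fin 2 → ℝ} (hq : ∀ j s, q j s ∈ Set.Ioo (0 : ℝ) 1) (j : ℕ)
    (v : CountVec n ℓ) (c : StateVec n) :
    ∏ k, cellKernel (q j (cellState (v k))) (v k) (newState v c k) =
      Real.exp (-∑ k, cellInfo ℓ q j (v k, c k)) := by
  rw [← Finset.sum_neg_distrib, Real.exp_sum]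
  refine Finset.prod_congr rfl fun k _ => ?_
  rw [newState_apply, cellKernel_output, cellInfo]
  split_ifs
  · rw [neg_neg, Real.exp_log (bern_pos (hq _ _) _)]
  · simp

/-- Direct part: the rates of every interior kernel are achievable by partially informed
encoders. -/
lemma achievable_cellRate {q : ℕ → Fin 2 → ℝ} (hq : ∀ j s, q j s ∈ Set.Ioo (0 : ℝ) 1) :
    Achievable .EIP t ℓ fun j => cellRate ℓ q j / Real.log 2 := by
  classical
  intro ε hε
  have hl2 : 0 < Real.log 2 := Real.log_pos (by norm_num)
  have hq' : ∀ j s, q j s ∈ Set.Icc (0 : ℝ) 1 := fun j s => Set.Ioo_subset_Icc_self (hq j s)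
  -- The rate loses `2 * δ` nats, one `δ` for typicality and one for collisions; this equals `ε`
  -- bits.
  set δ : ℝ := ε * Real.log 2 / 2 with hδ_def
  have hδ : 0 < δ := by positivity
  set V : ℕ → ℝ := fun j => ∑ x, cellJoint ℓ q j x *
    (cellInfo ℓ q j x - ∑ y, cellJoint ℓ q j y * cellInfo ℓ q j y) ^ 2 with hV
  have hlim : Filter.Tendsto (fun n : ℕ => ∑ i ∈ Finset.range t,
      (V i / δ ^ 2 / n + Real.exp (-(n * δ)))) Filter.atTop (nhds 0) := by
    have h1 : ∀ i, Filter.Tendsto (fun n : ℕ => V i / δ ^ 2 / n + Real.exp (-(n * δ)))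
        Filter.atTop (nhds 0) := by
      intro i
      rw [← add_zero (0 : ℝ)]
      refine (tendsto_const_div_atTop_nhds_zero_nat _).add ?_
      exact Real.tendsto_exp_neg_atTop_nhds_zero.comp
        (tendsto_natCast_atTop_atTop.atTop_mul_const hδ)
    simpa using tendsto_finsetSum (Finset.range t) fun i _ => h1 i
  obtain ⟨n, hnε, hn⟩ :=
    ((hlim.eventually (ge_mem_nhds hε)).and (Filter.eventually_gt_atTop 0)).exists
  have hn' : (0 : ℝ) < n := by exact_mod_cast hn
  refine ⟨n, hn, ?_⟩
  set r : ℕ → ℝ := cellRate ℓ q with hr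
  set γ : ℕ → ℝ := fun j => Real.exp (-(n * (r j - δ))) with hγ
  set M : ℕ → ℕ := fun j => ⌈Real.exp (n * (r j - 2 * δ))⌉₊ with hM_def
  have hM : ∀ j, 0 < M j := fun j => Nat.ceil_pos.2 (Real.exp_pos _)
  let T : ℕ → CountVec n ℓ → StateVec n → Prop := fun j v y =>
    ∏ k, cellKernel (q j (cellState (v k))) (v k) (y k) ≤ γ j
  obtain ⟨C, hCM, hCe⟩ := exists_code (ℓ := ℓ) (blockKernel q)
    (fun j s c => Finset.prod_nonneg fun k _ => bern_nonneg (hq' _ _) _) (sum_blockKernel q) hM T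
    (γ := γ) (fun j => (Real.exp_pos _).le)
    (fun j v y hT => by
      refine le_trans (le_of_eq ?_) hT
      simp_rw [← sum_bern_mul_output]
      rw [← sum_prod_eq_prod_sum fun k c => bern (q j (cellState (v k))) c *
        (if cellOutput (v k) c = y k then 1 else 0)]
      refine Finset.sum_congr rfl fun c _ => ?_
      rw [Finset.prod_mul_distrib, ← prod_ite_eq_ite]
      rfl) t
  have hcost : ∑ j, C.errorProb j ≤ ε := by
    refine hCe.trans ?_
    -- The cost from count `0` is read as an average over the initial product law, a point mass.
    rw [← sum_blockProb_zero (ℓ := ℓ) q (expectedCost _ _ _ _), sum_blockProb_mul_expectedCost]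
    refine le_trans (Finset.sum_le_sum fun i _ => ?_) hnε
    simp only [zero_add, mul_add, Finset.sum_add_distrib]
    refine add_le_add ?_ ?_
    · refine le_trans ?_ (sum_prod_lower_tail_le (w := cellJoint ℓ q i)
        (fun x => mul_nonneg (cellProb_nonneg hq' _ _) (bern_nonneg (hq' _ _) _))
        (sum_cellJoint q i) (cellInfo ℓ q i) hn hδ)
      rw [sum_cellJoint_mul_cellInfo,
        ← (Equiv.arrowProdEquivProdArrow (Fin n) (fun _ => Fin (ℓ + 1)) (fun _ => Fin 2)).symm.sum_comp,
        Fintype.sum_prod_type]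
      refine Finset.sum_le_sum fun v _ => ?_
      rw [Finset.mul_sum]
      refine Finset.sum_le_sum fun c _ => ?_
      rw [← mul_assoc]
      have h1 : blockProb n ℓ q i v * blockKernel q i (parity v) c =
          ∏ k, cellJoint ℓ q i (v k, c k) := Finset.prod_mul_distrib.symm
      rw [h1]
      refine mul_le_mul_of_nonneg_left ?_ (Finset.prod_nonneg fun k _ =>
        mul_nonneg (cellProb_nonneg hq' _ _) (bern_nonneg (hq' _ _) _))
      simp only [T, prod_cellKernel_newState hq, hγ, Real.exp_le_exp]
      change (if _ then (0 : ℝ) else 1) ≤ if ∑ k, cellInfo ℓ q i (v k, c k) < _ then 1 else 0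
      split_ifs with h2 h3 h3
      · norm_num
      · norm_num
      · norm_num
      · exact absurd (by linarith) h2
    · have h1 : ∑ v, blockProb n ℓ q i v = 1 := sum_prod_weights fun _ => sum_cellProb ℓ q i
      rw [← Finset.sum_mul, h1, one_mul]
      -- Only the `M - 1` competing messages count, which absorbs the rounding up in `M`.
      have h2 : (M i : ℝ) - 1 ≤ Real.exp (n * (r i - 2 * δ)) := by
        have := Nat.ceil_lt_add_one (Real.exp_pos (n * (r i - 2 * δ))).le
        simp only [hM_def]
        linarith
      calc ((M i : ℝ) - 1) * γ i ≤ Real.exp (n * (r i - 2 * δ)) * γ i :=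
            mul_le_mul_of_nonneg_right h2 (Real.exp_pos _).le
        _ = Real.exp (-(n * δ)) := by
            simp only [hγ]
            rw [← Real.exp_add]
            congr 1
            ring
  refine ⟨C, fun j => ⟨?_, ?_⟩⟩
  · exact (Finset.single_le_sum (fun i _ => C.errorProb_nonneg i) (Finset.mem_univ j)).trans hcost
  · have h1 : n * (r j - 2 * δ) ≤ Real.log (C.M j) := by
      rw [hCM, Real.le_log_iff_exp_le (by exact_mod_cast hM j)]
      exact Nat.le_ceil _
    have h2 : C.rate j = Real.log (C.M j) / n / Real.log 2 := by
      unfold Code.rate Real.logb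
      ring
    rw [h2, le_div_iff₀ hl2, le_div_iff₀ hn', sub_mul, div_mul_cancel₀ _ hl2.ne']
    have h3 : ε * Real.log 2 = 2 * δ := by rw [hδ_def]; ring
    rw [h3]
    linarith

/-! ### Dependence of the sum-rate on one parameter, and interior maximisers. -/

lemma continuous_cellProb (i : ℕ) (a : Fin (ℓ + 1)) :
    Continuous fun p : ℕ → ℝ => cellProb ℓ (fun j _ => p j) i a := by
  induction i generalizing a with
  | zero => exact continuous_const
  | succ i ih =>
    refine continuous_finsetSum _ fun u _ => continuous_finsetSum _ fun c _ => ?_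
    refine ((ih u).mul ?_).mul continuous_const
    unfold bern
    split_ifs <;> fun_prop

lemma continuous_cellSumRate :
    Continuous fun p : ℕ → ℝ => cellSumRate ℓ t fun j _ => p j := by
  refine continuous_finsetSum _ fun i _ => continuous_finsetSum _ fun u _ => ?_
  refine (continuous_cellProb i u).mul ?_
  split_ifs
  · exact Real.binEntropy_continuous.comp (continuous_apply i)
  · exact continuous_const

/-- The kernel `q` with the values on write `j` from states in `S` replaced by `x`. -/
def modify (q : ℕ → Fin 2 → ℝ) (j : ℕ) (S : Finset (Fin 2)) (x : ℝ) : ℕ → Fin 2 → ℝ :=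
  fun i s => if i = j ∧ s ∈ S then x else q i s

lemma modify_of_ne (q : ℕ → Fin 2 → ℝ) {i j : ℕ} (h : i ≠ j) (S : Finset (Fin 2)) (x : ℝ) :
    modify q j S x i = q i := by
  funext s; simp [modify, h]

lemma cellProb_modify_of_le (q : ℕ → Fin 2 → ℝ) {i j : ℕ} (h : i ≤ j) (S : Finset (Fin 2))
    (x : ℝ) : cellProb ℓ (modify q j S x) i = cellProb ℓ q i :=
  cellProb_congr fun k hk => modify_of_ne q (by omega) S x

lemma exists_affine_sum {ι : Type*} (s : Finset ι) {f : ι → ℝ → ℝ}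
    (h : ∀ i ∈ s, ∃ α β : ℝ, ∀ x, f i x = α + β * x) :
    ∃ α β : ℝ, ∀ x, ∑ i ∈ s, f i x = α + β * x := by
  choose! α β h using h
  refine ⟨∑ i ∈ s, α i, ∑ i ∈ s, β i, fun x => ?_⟩
  rw [Finset.sum_mul, ← Finset.sum_add_distrib]
  exact Finset.sum_congr rfl fun i hi => h i hi x

lemma exists_affine_mul_const {f : ℝ → ℝ} (h : ∃ α β : ℝ, ∀ x, f x = α + β * x) (c : ℝ) :
    ∃ α β : ℝ, ∀ x, f x * c = α + β * x := by
  obtain ⟨α, β, h⟩ := h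
  exact ⟨α * c, β * c, fun x => by rw [h]; ring⟩

/-- The law of a Markov chain is affine in the transition of any single step. -/
lemma exists_affine_cellProb (q : ℕ → Fin 2 → ℝ) (j : ℕ) (S : Finset (Fin 2)) (i : ℕ)
    (a : Fin (ℓ + 1)) : ∃ α β : ℝ, ∀ x, cellProb ℓ (modify q j S x) i a = α + β * x := by
  induction i generalizing a with
  | zero => exact ⟨cellProb ℓ q 0 a, 0, fun x => by simp [cellProb]⟩
  | succ i ih =>
    refine exists_affine_sum _ fun u _ => exists_affine_sum _ fun c _ =>
      exists_affine_mul_const ?_ _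
    by_cases hij : i = j
    · subst hij
      simp only [cellProb_modify_of_le q le_rfl S]
      simp only [mul_comm (cellProb ℓ q i u)]
      refine exists_affine_mul_const ?_ _
      simp only [modify, true_and, bern]
      split_ifs
      · exact ⟨0, 1, fun x => by ring⟩
      · exact ⟨_, 0, fun x => by rw [zero_mul, add_zero]⟩
      · exact ⟨1, -1, fun x => by ring⟩
      · exact ⟨_, 0, fun x => by rw [zero_mul, add_zero]⟩
    · simp only [modify_of_ne q hij S]
      exact exists_affine_mul_const (ih u) _

lemma exists_cellRate_modify_self (q : ℕ → Fin 2 → ℝ) (j : ℕ) (S : Finset (Fin 2)) :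
    ∃ a : ℝ, ∀ x, cellRate ℓ (modify q j S x) j = a +
      (∑ u : Fin (ℓ + 1), if (u : ℕ) < ℓ ∧ cellState u ∈ S then cellProb ℓ q j u else 0) *
        Real.binEntropy x := by
  refine ⟨∑ u : Fin (ℓ + 1), if (u : ℕ) < ℓ ∧ cellState u ∉ S then
    cellProb ℓ q j u * Real.binEntropy (q j (cellState u)) else 0, fun x => ?_⟩
  rw [Finset.sum_mul, ← Finset.sum_add_distrib]
  refine Finset.sum_congr rfl fun u _ => ?_
  rw [cellProb_modify_of_le q le_rfl]
  by_cases h1 : (u : ℕ) < ℓ <;> by_cases h2 : cellState u ∈ S <;> simp [h1, h2, modify]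

/-- Other writes feel `x` at most through the law of the count, hence affinely. The entropy term
comes from write `j` itself, weighted by the mass of the live cells with state in `S`. -/
lemma exists_cellSumRate_modify (q : ℕ → Fin 2 → ℝ) {j : ℕ} (hj : j < t) (S : Finset (Fin 2)) :
    ∃ a b : ℝ, ∀ x, cellSumRate ℓ t (modify q j S x) = a + b * x +
      (∑ u : Fin (ℓ + 1), if (u : ℕ) < ℓ ∧ cellState u ∈ S then cellProb ℓ q j u else 0) *
        Real.binEntropy x := by
  obtain ⟨a, ha⟩ := exists_cellRate_modify_self (ℓ := ℓ) q j S
  have h : ∃ α β : ℝ, ∀ x,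
      ∑ i ∈ (Finset.range t).erase j, cellRate ℓ (modify q j S x) i = α + β * x := by
    refine exists_affine_sum _ fun i hi => exists_affine_sum _ fun u _ => ?_
    simp only [modify_of_ne q (Finset.ne_of_mem_erase hi) S]
    exact exists_affine_mul_const (exists_affine_cellProb q j S i u) _
  obtain ⟨α, β, h⟩ := h
  refine ⟨a + α, β, fun x => ?_⟩
  rw [cellSumRate, ← Finset.add_sum_erase _ _ (Finset.mem_range.2 hj), h, ha]
  ring

/-- Infinite slope of the entropy at `0`: for the chosen `x` one has `-log x = (|b| + 1) / A`, so
the entropy term is at least `x * (|b| + 1)` and outweighs `b * x`. -/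
lemma exists_pos_linear_add_binEntropy (b : ℝ) {A : ℝ} (hA : 0 < A) :
    ∃ x ∈ Set.Ioo (0 : ℝ) 1, 0 < b * x + A * Real.binEntropy x := by
  refine ⟨Real.exp (-((|b| + 1) / A)), ⟨Real.exp_pos _, ?_⟩, ?_⟩
  · rw [Real.exp_lt_one_iff]
    have : 0 < (|b| + 1) / A := by positivity
    linarith
  · set x := Real.exp (-((|b| + 1) / A)) with hx
    have hx0 : 0 < x := Real.exp_pos _
    have hx1 : x < 1 := by
      rw [hx, Real.exp_lt_one_iff]
      have : 0 < (|b| + 1) / A := by positivity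
      linarith
    have hlog : Real.log x = -((|b| + 1) / A) := Real.log_exp _
    have h1 : x * ((|b| + 1) / A) ≤ Real.binEntropy x := by
      rw [Real.binEntropy, Real.log_inv, Real.log_inv, hlog, neg_neg]
      have := mul_nonneg (sub_nonneg.2 hx1.le) (neg_nonneg.2
        (Real.log_nonpos (sub_nonneg.2 hx1.le) (by linarith)))
      linarith
    have h2 : A * (x * ((|b| + 1) / A)) = x * (|b| + 1) := by field_simp
    have h3 := mul_le_mul_of_nonneg_left h1 hA.le
    have h4 := neg_abs_le b
    nlinarith

lemma mem_Ioo_of_isMax {a b A x₀ : ℝ} (hA : 0 < A) (hx₀ : x₀ ∈ Set.Icc (0 : ℝ) 1)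
    (h : ∀ x ∈ Set.Icc (0 : ℝ) 1, a + b * x + A * Real.binEntropy x ≤
      a + b * x₀ + A * Real.binEntropy x₀) : x₀ ∈ Set.Ioo (0 : ℝ) 1 := by
  refine ⟨lt_of_le_of_ne hx₀.1 ?_, lt_of_le_of_ne hx₀.2 ?_⟩
  · rintro rfl
    obtain ⟨x, hx, hpos⟩ := exists_pos_linear_add_binEntropy b hA
    have := h x (Set.Ioo_subset_Icc_self hx)
    simp at this
    linarith
  · rintro rfl
    -- The endpoint `1` is reflected to `0`, which reverses the slope.
    obtain ⟨x, hx, hpos⟩ := exists_pos_linear_add_binEntropy (-b) hA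
    have := h (1 - x) ⟨by linarith [hx.2], by linarith [hx.1]⟩
    simp at this
    linarith

lemma cellSumRate_congr {q q' : ℕ → Fin 2 → ℝ} (h : ∀ i < t, q i = q' i) :
    cellSumRate ℓ t q = cellSumRate ℓ t q' := by
  refine Finset.sum_congr rfl fun i hi => ?_
  rw [Finset.mem_range] at hi
  simp only [cellRate, cellProb_congr fun k (hk : k < i) => h k (hk.trans hi), h i hi]

/-- A kernel of an uninformed encoder of maximal sum-rate is interior. -/
lemma mem_Ioo_of_isMax_cellSumRate (hℓ : 0 < ℓ) {p : ℕ → ℝ} (hp : ∀ j, p j ∈ Set.Icc (0 : ℝ) 1)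
    (hmax : ∀ p' : ℕ → ℝ, (∀ j, p' j ∈ Set.Icc (0 : ℝ) 1) →
      cellSumRate ℓ t (fun j _ => p' j) ≤ cellSumRate ℓ t fun j _ => p j) (j : ℕ) (hj : j < t) :
    p j ∈ Set.Ioo (0 : ℝ) 1 := by
  induction j using Nat.strong_induction_on with
  | _ j ih =>
    obtain ⟨a, b, hab⟩ := exists_cellSumRate_modify (ℓ := ℓ) (fun j _ => p j) hj Finset.univ
    have hmod : ∀ x, modify (fun j _ => p j) j Finset.univ x =
        fun i _ => Function.update p j x i := by
      intro x
      funext i s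
      simp [modify, Function.update_apply]
    -- Since the earlier writes are interior by induction, count `0` still has positive mass at
    -- write `j`.
    have hA : 0 < ∑ u : Fin (ℓ + 1), if (u : ℕ) < ℓ ∧ cellState u ∈ (Finset.univ : Finset (Fin 2))
        then cellProb ℓ (fun j _ => p j) j u else 0 := by
      refine Finset.sum_pos' (fun u _ => ?_) ⟨0, Finset.mem_univ _, ?_⟩
      · split_ifs
        exacts [cellProb_nonneg (fun _ _ => hp _) _ _, le_rfl]
      · simp only [Fin.val_zero, hℓ, Finset.mem_univ, and_self, if_true]
        exact cellProb_pos (fun i hi _ => ih i hi (hi.trans hj)) (fun _ _ => hp _) _ (by simp)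
    refine mem_Ioo_of_isMax (a := a) (b := b) hA (hp j) fun x hx => ?_
    have h1 := hab x
    have h2 := hab (p j)
    rw [hmod] at h1 h2
    rw [Function.update_eq_self] at h2
    rw [← h1, ← h2]
    refine hmax _ fun i => ?_
    rw [Function.update_apply]
    split_ifs
    exacts [hx, hp i]

/-! ### Perturbation of the second to last write and the strict gap. -/

lemma sum_bern_mul_alive (hℓ : 1 ≤ ℓ) (p : ℝ) (u : Fin (ℓ + 1)) :
    ∑ c, bern p c * (if (cellCount u c : ℕ) < ℓ then 1 else 0) =
      if (u : ℕ) < ℓ then (if (u : ℕ) = ℓ - 1 then bern p (cellState u) else 1) else 0 := by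
  have hc : ∀ c, ((cellCount u c : ℕ) < ℓ) ↔
      (u : ℕ) < ℓ ∧ ((u : ℕ) = ℓ - 1 → c = cellState u) := by
    intro c
    unfold cellCount
    have := u.isLt
    split_ifs with h
    · simp [h]
    · simp only [h, imp_false]
      omega
  simp only [hc]
  by_cases h1 : (u : ℕ) < ℓ
  · by_cases h2 : (u : ℕ) = ℓ - 1
    · simp only [eq_true h1, eq_true h2, true_and, forall_const, if_true]
      simp
    · simp only [h1, h2, false_imp_iff, and_self, if_true, mul_one, sum_bern, if_false]
  · simp [h1]

/-- The dependence of the sum-rate on the second to last write from state `s`. -/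
lemma exists_cellSumRate_modify_penultimate (hℓ : 1 ≤ ℓ) (q : ℕ → Fin 2 → ℝ) (j : ℕ)
    (hq : ∀ s, q (j + 1) s = q (j + 1) 0) (w : Fin (ℓ + 1)) (hw : (w : ℕ) = ℓ - 1) (s : Fin 2) :
    ∃ a : ℝ, ∀ x, cellSumRate ℓ (j + 2) (modify q j {s} x) = a +
      (∑ u : Fin (ℓ + 1), if (u : ℕ) < ℓ ∧ cellState u ∈ ({s} : Finset (Fin 2))
        then cellProb ℓ q j u else 0) * Real.binEntropy x +
      Real.binEntropy (q (j + 1) 0) * cellProb ℓ q j w *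
        bern (if cellState w = s then x else q j (cellState w)) (cellState w) := by
  obtain ⟨a, ha⟩ := exists_cellRate_modify_self (ℓ := ℓ) q j {s}
  refine ⟨∑ i ∈ Finset.range j, cellRate ℓ q i + a + Real.binEntropy (q (j + 1) 0) *
    ∑ u ∈ Finset.univ.erase w, (if (u : ℕ) < ℓ then cellProb ℓ q j u else 0), fun x => ?_⟩
  have h1 : ∀ i ∈ Finset.range j, cellRate ℓ (modify q j {s} x) i = cellRate ℓ q i := by
    intro i hi
    rw [Finset.mem_range] at hi
    simp only [cellRate, cellProb_modify_of_le q hi.le, modify_of_ne q hi.ne]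
  -- By `hq` the last write earns the same entropy from every live cell, so only the survival
  -- probability matters; write `j` affects it only at count `ℓ - 1`.
  have h2 : cellRate ℓ (modify q j {s} x) (j + 1) = Real.binEntropy (q (j + 1) 0) *
      ∑ u, cellProb ℓ q j u * (if (u : ℕ) < ℓ then (if (u : ℕ) = ℓ - 1 then
        bern (modify q j {s} x j (cellState u)) (cellState u) else 1) else 0) := by
    have h3 := sum_cellProb_succ ℓ (modify q j {s} x) j fun u => if (u : ℕ) < ℓ then 1 else 0
    simp only [sum_bern_mul_alive hℓ, cellProb_modify_of_le q le_rfl] at h3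
    rw [← h3, cellRate, Finset.mul_sum]
    refine Finset.sum_congr rfl fun u _ => ?_
    rw [modify_of_ne q (by omega), hq]
    split_ifs <;> ring
  rw [cellSumRate, Finset.sum_range_succ, Finset.sum_range_succ, Finset.sum_congr rfl h1, ha, h2]
  have h4 : ∀ u ∈ Finset.univ.erase w, cellProb ℓ q j u * (if (u : ℕ) < ℓ then
      (if (u : ℕ) = ℓ - 1 then bern (modify q j {s} x j (cellState u)) (cellState u) else 1)
        else 0) = if (u : ℕ) < ℓ then cellProb ℓ q j u else 0 := by
    intro u hu
    have : (u : ℕ) ≠ ℓ - 1 := fun h => Finset.ne_of_mem_erase hu (Fin.ext (h.trans hw.symm))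
    simp [this]
  have h5 : (w : ℕ) < ℓ := by omega
  rw [← Finset.add_sum_erase _ (fun u => cellProb ℓ q j u * _) (Finset.mem_univ w),
    Finset.sum_congr rfl h4, if_pos h5, if_pos hw]
  simp only [modify, true_and, Finset.mem_singleton]
  ring

lemma hasDerivAt_bern (c : Fin 2) (x : ℝ) :
    HasDerivAt (fun y => bern y c) (if c = 1 then 1 else -1) x := by
  unfold bern
  split_ifs
  · exact hasDerivAt_id x
  · simpa using (hasDerivAt_id x).const_sub 1

/-- Knowledge of the cell states strictly increases the single-letter sum-rate. -/
lemma exists_cellSumRate_gap (hℓ : 2 ≤ ℓ) (ht : ℓ < t) :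
    ∃ S : ℝ, (∀ p : ℕ → ℝ, (∀ j, p j ∈ Set.Icc (0 : ℝ) 1) →
        cellSumRate ℓ t (fun j _ => p j) ≤ S) ∧
      ∃ q : ℕ → Fin 2 → ℝ, (∀ j s, q j s ∈ Set.Ioo (0 : ℝ) 1) ∧ S < cellSumRate ℓ t q := by
  have hcomp : IsCompact (Set.univ.pi fun _ : ℕ => Set.Icc (0 : ℝ) 1) :=
    isCompact_univ_pi fun _ => isCompact_Icc
  obtain ⟨p, hp, hmax⟩ := hcomp.exists_isMaxOn ⟨fun _ => 0, fun _ _ => ⟨le_rfl, zero_le_one⟩⟩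
    (continuous_cellSumRate (ℓ := ℓ) (t := t)).continuousOn
  rw [Set.mem_univ_pi] at hp
  have hmax' : ∀ p' : ℕ → ℝ, (∀ j, p' j ∈ Set.Icc (0 : ℝ) 1) →
      cellSumRate ℓ t (fun j _ => p' j) ≤ cellSumRate ℓ t fun j _ => p j :=
    fun p' hp' => hmax (Set.mem_univ_pi.2 hp')
  refine ⟨_, hmax', ?_⟩
  have hint := mem_Ioo_of_isMax_cellSumRate (by omega) hp hmax'
  by_contra! hcon
  -- Writes beyond `t` do not affect the sum; the value `1 / 2` there makes `q` interior everywhere.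
  set q : ℕ → Fin 2 → ℝ := fun j _ => if j < t then p j else 1 / 2 with hq
  have hqI : ∀ j s, q j s ∈ Set.Ioo (0 : ℝ) 1 := by
    intro j s
    simp only [hq]
    split_ifs with h
    · exact hint j h
    · constructor <;> norm_num
  have hqC : ∀ j s, q j s ∈ Set.Icc (0 : ℝ) 1 := fun j s => Set.Ioo_subset_Icc_self (hqI j s)
  have hqS : cellSumRate ℓ t (fun j _ => p j) = cellSumRate ℓ t q :=
    cellSumRate_congr fun i hi => by funext s; simp [hq, hi]
  obtain ⟨j, rfl⟩ : ∃ j, t = j + 2 := ⟨t - 2, by omega⟩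
  set x₀ := q j 0 with hx₀
  have hx₀I : x₀ ∈ Set.Ioo (0 : ℝ) 1 := hqI j 0
  let w : Fin (ℓ + 1) := ⟨ℓ - 1, by omega⟩
  let w' : Fin (ℓ + 1) := ⟨ℓ - 2, by omega⟩
  set B : Fin 2 → ℝ := fun s => ∑ u : Fin (ℓ + 1),
    if (u : ℕ) < ℓ ∧ cellState u ∈ ({s} : Finset (Fin 2)) then cellProb ℓ q j u else 0 with hB
  set h' : ℝ := Real.log (1 - x₀) - Real.log x₀ with hh'
  have hent : HasDerivAt Real.binEntropy h' x₀ :=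
    Real.hasDerivAt_binEntropy hx₀I.1.ne' hx₀I.2.ne
  -- If no interior state-dependent kernel improved on `p`, then `x₀` would be optimal for each
  -- state separately.
  have hlocal : ∀ s, IsLocalMax (fun x => cellSumRate ℓ (j + 2) (modify q j {s} x)) x₀ := by
    intro s
    have hself : modify q j {s} x₀ = q := by
      funext i s'
      simp only [modify]
      split_ifs with h
      · rw [h.1]
      · rfl
    filter_upwards [Ioo_mem_nhds hx₀I.1 hx₀I.2] with x hx
    rw [hself, ← hqS]
    refine hcon _ fun i s' => ?_
    unfold modify
    split_ifs
    exacts [hx, hqI i s']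
  have hww' : cellState w ≠ cellState w' := by
    simp only [cellState, w, w', ne_eq, Fin.mk.injEq]
    omega
  have h1 : B (cellState w') * h' = 0 := by
    obtain ⟨a, ha⟩ := exists_cellSumRate_modify_penultimate (by omega) q j (fun _ => rfl) w rfl
      (cellState w')
    refine (hlocal (cellState w')).hasDerivAt_eq_zero ?_
    simp only [ha, if_neg hww']
    exact ((hent.const_mul _).const_add a).add_const _
  -- Count `ℓ - 2` exists because `2 ≤ ℓ`, is alive, and is reachable in `j` writes.
  have hB' : 0 < B (cellState w') := by
    refine Finset.sum_pos' (fun u _ => ?_) ⟨w', Finset.mem_univ _, ?_⟩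
    · split_ifs
      exacts [cellProb_nonneg hqC _ _, le_rfl]
    · have : (w' : ℕ) < ℓ := by simp only [w']; omega
      simp only [this, Finset.mem_singleton, and_self, if_true]
      exact cellProb_pos (fun i _ => hqI i) hqC _ (by simp only [w']; omega)
  have hh0 : h' = 0 := (mul_eq_zero.1 h1).resolve_left hB'.ne'
  have h2 : B (cellState w) * h' + Real.binEntropy (q (j + 1) 0) * cellProb ℓ q j w *
      (if cellState w = 1 then 1 else -1) = 0 := by
    obtain ⟨a, ha⟩ := exists_cellSumRate_modify_penultimate (by omega) q j (fun _ => rfl) w rfl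
      (cellState w)
    refine (hlocal (cellState w)).hasDerivAt_eq_zero ?_
    simp only [ha, if_true]
    exact ((hent.const_mul _).const_add a).add ((hasDerivAt_bern _ _).const_mul _)
  have h3 : 0 < Real.binEntropy (q (j + 1) 0) :=
    Real.binEntropy_pos (hqI _ 0).1 (hqI _ 0).2
  -- Count `ℓ - 1` is reachable in `j = t - 2` writes exactly because `ℓ < t`.
  have h4 : 0 < cellProb ℓ q j w :=
    cellProb_pos (fun i _ => hqI i) hqC _ (by simp only [w]; omega)
  rw [hh0, mul_zero, zero_add] at h2
  have h5 := mul_pos h3 h4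
  split_ifs at h2 <;> linarith

/-! ### Compactness of the capacity regions, their inclusion and the conclusion. -/

lemma le_of_mem_capacityRegion {R : Fin t → ℝ} (hR : R ∈ capacityRegion X t ℓ) (j : Fin t) :
    R j ≤ 5 / 2 + 1 / Real.log 2 := by
  obtain ⟨n, hn, C, hC⟩ := hR.2 (1 / 2) (by norm_num)
  obtain ⟨h1, h2⟩ := hC j
  have := C.rate_le hn j h1
  linarith

/-- The slack in achievability absorbs limits: half of `ε` goes to approximating the tuple, half to
the code. -/
lemma isClosed_capacityRegion : IsClosed (capacityRegion X t ℓ) := by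
  refine isClosed_of_closure_subset fun R hR => ⟨fun j => ?_, fun ε hε => ?_⟩
  · have hcl : IsClosed {R : Fin t → ℝ | 0 ≤ R j} :=
      isClosed_le continuous_const (continuous_apply j)
    exact closure_minimal (fun R' hR' => hR'.1 j) hcl hR
  · obtain ⟨R', hR', hdist⟩ := Metric.mem_closure_iff.1 hR (ε / 2) (half_pos hε)
    obtain ⟨n, hn, C, hC⟩ := hR'.2 (ε / 2) (half_pos hε)
    refine ⟨n, hn, C, fun j => ⟨(hC j).1.trans (by linarith), ?_⟩⟩
    have h1 := (dist_le_pi_dist R R' j).trans_lt hdist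
    rw [Real.dist_eq] at h1
    have h2 := (abs_lt.1 h1).2
    have h3 := (hC j).2
    linarith

lemma isCompact_capacityRegion : IsCompact (capacityRegion X t ℓ) :=
  (isCompact_univ_pi fun _ : Fin t =>
    isCompact_Icc (a := (0 : ℝ)) (b := 5 / 2 + 1 / Real.log 2)).of_isClosed_subset
    isClosed_capacityRegion fun _ hR =>
      Set.mem_univ_pi.2 fun j => ⟨hR.1 j, le_of_mem_capacityRegion hR j⟩

lemma zero_mem_capacityRegion : (0 : Fin t → ℝ) ∈ capacityRegion X t ℓ := by
  refine ⟨fun _ => le_rfl, fun ε hε => ⟨1, one_pos, ?_⟩⟩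
  let C : Code X 1 t ℓ := ⟨fun _ => 1, fun _ => one_pos, fun _ _ _ => 0, fun _ _ _ => 0⟩
  refine ⟨C, fun j => ⟨?_, ?_⟩⟩
  · have h : C.errorProb j = 0 := by
      refine Finset.sum_eq_zero fun m _ => Finset.sum_eq_zero fun v _ => ?_
      have : C.dec j (newState v (C.target j m v)) v = m := Subsingleton.elim (α := Fin 1) _ _
      rw [if_pos this, mul_zero]
    rw [h]
    exact hε.le
  · have h : C.rate j = 0 := by simp [Code.rate, C]
    rw [h]
    simpa using hε.le

lemma isCompact_sumRates : IsCompact (sumRates X t ℓ) :=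
  isCompact_capacityRegion.image (by fun_prop)

lemma isGreatest_maxSumRate : IsGreatest (sumRates X t ℓ) (maxSumRate X t ℓ) :=
  isCompact_sumRates.isGreatest_sSup ⟨_, Set.mem_image_of_mem _ zero_mem_capacityRegion⟩

/-- The code in which partially informed encoders ignore the cell states. -/
def Code.toEIP (C : Code .EU n t ℓ) : Code .EIP n t ℓ where
  M := C.M
  M_pos := C.M_pos
  enc j m _ := C.enc j m ()
  dec := C.dec

lemma Code.countProb_toEIP (C : Code .EU n t ℓ) (j : ℕ) (hj : j ≤ t) :
    C.toEIP.countProb j hj = C.countProb j hj := by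
  induction j with
  | zero => rfl
  | succ j ih =>
    funext v
    simp only [Code.countProb, ih]
    rfl

lemma Code.errorProb_toEIP (C : Code .EU n t ℓ) (j : Fin t) :
    C.toEIP.errorProb j = C.errorProb j := by
  unfold Code.errorProb
  rw [C.countProb_toEIP]
  rfl

lemma capacityRegion_EU_subset_EIP : capacityRegion .EU t ℓ ⊆ capacityRegion .EIP t ℓ := by
  refine fun R hR => ⟨hR.1, fun ε hε => ?_⟩
  obtain ⟨n, hn, C, hC⟩ := hR.2 ε hε
  exact ⟨n, hn, C.toEIP, fun j => ⟨(C.errorProb_toEIP j).trans_le (hC j).1, (hC j).2⟩⟩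

lemma cellRate_nonneg {q : ℕ → Fin 2 → ℝ} (hq : ∀ j s, q j s ∈ Set.Icc (0 : ℝ) 1) (j : ℕ) :
    0 ≤ cellRate ℓ q j := by
  refine Finset.sum_nonneg fun u _ => mul_nonneg (cellProb_nonneg hq j u) ?_
  split_ifs
  exacts [Real.binEntropy_nonneg (hq _ _).1 (hq _ _).2, le_rfl]

lemma maxSumRate_EU_lt_EIP (hℓ : 2 ≤ ℓ) (ht : ℓ < t) :
    maxSumRate .EU t ℓ < maxSumRate .EIP t ℓ := by
  have hl2 : 0 < Real.log 2 := Real.log_pos (by norm_num)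
  obtain ⟨S, hS, q, hq, hlt⟩ := exists_cellSumRate_gap hℓ ht
  obtain ⟨R, hR, hRS⟩ := (isGreatest_maxSumRate (X := .EU) (t := t) (ℓ := ℓ)).1
  have h1 : maxSumRate .EU t ℓ ≤ S / Real.log 2 := by
    rw [le_div_iff₀ hl2, ← hRS]
    exact sum_mul_log_two_le_of_achievable hR.2 hS
  have h2 : cellSumRate ℓ t q / Real.log 2 ∈ sumRates .EIP t ℓ := by
    refine ⟨fun j => cellRate ℓ q j / Real.log 2, ⟨fun j => ?_, achievable_cellRate hq⟩, ?_⟩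
    · exact div_nonneg (cellRate_nonneg (fun j s => Set.Ioo_subset_Icc_self (hq j s)) j) hl2.le
    · dsimp only
      rw [← Finset.sum_div, cellSumRate, Fin.sum_univ_eq_sum_range (fun j => cellRate ℓ q j)]
  calc maxSumRate .EU t ℓ ≤ S / Real.log 2 := h1
    _ < cellSumRate ℓ t q / Real.log 2 := by gcongr
    _ ≤ maxSumRate .EIP t ℓ := isGreatest_maxSumRate.2 h2

end ELM

end

theorem mainTheorem7 (t ℓ : ℕ) (hℓ : 2 ≤ ℓ) (ht : ℓ < t) :
    IsGreatest (ELM.sumRates .EU t ℓ) (ELM.maxSumRate .EU t ℓ) ∧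
    IsGreatest (ELM.sumRates .EIP t ℓ) (ELM.maxSumRate .EIP t ℓ) ∧
    ELM.maxSumRate .EU t ℓ < ELM.maxSumRate .EIP t ℓ ∧
    ELM.capacityRegion .EU t ℓ ⊂ ELM.capacityRegion .EIP t ℓ := by
  refine ⟨ELM.isGreatest_maxSumRate, ELM.isGreatest_maxSumRate, ELM.maxSumRate_EU_lt_EIP hℓ ht,
    ELM.capacityRegion_EU_subset_EIP.ssubset_of_ne fun h => ?_⟩
  have hlt := ELM.maxSumRate_EU_lt_EIP hℓ ht
  rw [ELM.maxSumRate, ELM.maxSumRate, ELM.sumRates, ELM.sumRates, h] at hlt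
  exact lt_irrefl _ hlt
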